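/- Let $(\mathcal E,\mathcal F)$ be a resistance form (in the sense of Kigami) on a nonempty set $X$ such that $X$ is compact with respect to the resistance metric $R$, and let $(V_m)_m$ be an increasing sequence of finite subsets of $X$ with dense union. Let $c(V_m;p,q)$ be the conductances of the trace $\mathcal E_{V_m}(v)=\inf\{\mathcal E(u):u\in\mathcal F,\ u|_{V_m}=v\}=\frac12\sum_{p,q\in V_m}c(V_m;p,q)(v(p)-v(q))^2$. For $g\in C(X)$ and an antisymmetric function $v$ on $X\times X$ put $(g\cdot v)(x,y)=\frac12(g(x)+g(y))\,v(x,y)$, and for $f\in\mathcal F$ put $d_uf(x,y)=f(x)-f(y)$. Let $\mathcal H$ be the Hilbert space obtained from the smallest linear space of functions on $X\times X$ that contains all $d_uf$, $f\in\mathcal F$, and is stable under $v\mapsto g\cdot v$, $g\in C(X)$, by completion with respect to $$\langle v,w\rangle_{\mathcal H}=\lim_{m\to\infty}\frac12\sum_{p,q\in V_m}c(V_m;p,q)\,v(p,q)\,w(p,q)$$ (after factoring out elements of zero seminorm). Let $\partial f\in\mathcal H$ be the class of $d_uf$, and let $g\cdot v$, $g\in C(X)$, $v\in\mathcal H$, be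 the continuous extension of the above action. Let $\mu$ be a finite Borel measure on $(X,R)$ with a uniform lower bound, that is, there is a nondecreasing $V:(0,\infty)\to(0,\infty)$ with $\mu(B(x,r))\ge V(r)$ for all $x\in X$, $r>0$. Let $0<\lambda<\Lambda$, and let $a_m\in C(X)$ satisfy $\lambda<a_m(x)<\Lambda$ for all $x\in X$ and all $m$. Let $b_m,\hat b_m\in\mathcal H$ with $B:=\sup_m\|b_m\|_{\mathcal H}^2<\infty$ and $\hat B:=\sup_m\|\hat b_m\|_{\mathcal H}^2<\infty$. Let $M>0$ be such that $$\lambda_0:=\frac{\lambda}{2}-\frac1{\sqrt M}>0,$$ put $\gamma_M:=\dfrac{2B}{V\left(1/(2MB)\right)}$ and $\hat\gamma_M:=\dfrac{2\hat B}{V(1/(2M\hat B))}$ (read as $0$ if $B=0$, respectively $\hat B=0$), and let $c\in L^\infty(X,\mu)$ be such that $$c_0:=\operatorname*{ess\,inf}_{x\in X}(-c(x))-\frac{\gamma_M+\hat\gamma_M}{\lambda-2/\sqrt M}>0 .$$ Consider the bilinear forms $$\mathcal Q_{(m)}(f,g)=\langle a_m\cdot\partial f,\partial g\rangle_{\mathcal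 H}-\langle g\cdot b_m,\partial f\rangle_{\mathcal H}-\langle f\cdot\hat b_m,\partial g\rangle_{\mathcal H}-\langle cf,g\rangle_{L^2(X,\mu)},\qquad f,g\in\mathcal F,$$ and their generators $\mathcal L^{\mathcal Q_{(m)}}$ on $L^2(X,\mu)$: $u\in\mathcal D(\mathcal L^{\mathcal Q_{(m)}})$ and $\mathcal L^{\mathcal Q_{(m)}}u=h$ mean that $u\in\mathcal F$, $h\in L^2(X,\mu)$ and $\mathcal Q_{(m)}(u,g)=-\langle h,g\rangle_{L^2(X,\mu)}$ for all $g\in\mathcal F$. (i) Let $f\in L^2(X,\mu)$, and let $u_m\in\mathcal F$ be the weak solution of $\mathcal L^{\mathcal Q_{(m)}}u_m=f$, that is, $\mathcal Q_{(m)}(u_m,g)=-\langle f,g\rangle_{L^2(X,\mu)}$ for all $g\in\mathcal F$. Then each subsequence of $(u_m)_m$ has a further subsequence that converges uniformly on $X$ to a limit $\widetilde u\in\mathcal F$. (ii) Let $\mathring u\in L^2(X,\mu)$, and let $u_m\in C^1((0,\infty),L^2(X,\mu))\cap C([0,\infty),L^2(X,\mu))$ be the solution of the Cauchy problem $\partial_tu_m(t)=\mathcal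 L^{\mathcal Q_{(m)}}u_m(t)$, $t>0$ (where $u_m(t)\in\mathcal D(\mathcal L^{\mathcal Q_{(m)}})$ for $t>0$), $u_m(0)=\mathring u$. Then for each $t>0$ each subsequence of $(u_m(t))_m$, where $u_m(t)$ is identified with its representative in $\mathcal F$, has a further subsequence that converges uniformly on $X$ to a limit $\widetilde u_t\in\mathcal F$. -/

import Mathlib

open MeasureTheory Filter Topology
open scoped ENNReal RealInnerProductSpace

noncomputable section

/-- A resistance form `(form, domain)` on a set `X`. -/
structure ResistanceForm (X : Type*) where
  /-- The space `F` of functions of finite energy. -/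
  domain : Submodule ℝ (X → ℝ)
  /-- The bilinear form on `F`. -/
  form : domain →ₗ[ℝ] domain →ₗ[ℝ] ℝ
  const_mem : ∀ r : ℝ, (fun _ : X => r) ∈ domain
  symm : ∀ u v, form u v = form v u
  nonneg : ∀ u, 0 ≤ form u u
  eq_zero_iff : ∀ u, form u u = 0 ↔ ∃ r : ℝ, ∀ x, (u : X → ℝ) x = r
  /-- `F` modulo constants is a Hilbert space: sequences that are Cauchy in energy converge in
  energy. -/
  complete : ∀ u : ℕ → domain,
    (∀ ε > 0, ∃ N, ∀ m ≥ N, ∀ n ≥ N, form (u m - u n) (u m - u n) < ε) →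
      ∃ v : domain, Tendsto (fun n => form (u n - v) (u n - v)) atTop (𝓝 0)
  /-- Any function on a finite set is the restriction of a function in `F`. -/
  exists_extension : ∀ (V : Finset X) (v : X → ℝ), ∃ u : domain, ∀ x ∈ V, (u : X → ℝ) x = v x
  /-- The supremum that defines the resistance between two points is finite. -/
  bddAbove_resistance : ∀ x y : X,
    BddAbove {r : ℝ | ∃ u : domain, 0 < form u u ∧
      r = ((u : X → ℝ) x - (u : X → ℝ) y) ^ 2 / form u u}
  /-- The unit contraction operates. -/
  markov : ∀ u : domain, ∃ h : (fun x => max 0 (min 1 ((u : X → ℝ) x))) ∈ domain,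
    form ⟨_, h⟩ ⟨_, h⟩ ≤ form u u

namespace ResistanceForm

variable {X : Type*} (E : ResistanceForm X)

/-- The resistance metric `R(x, y)`. -/
def resistance (x y : X) : ℝ :=
  sSup {r : ℝ | ∃ u : E.domain, 0 < E.form u u ∧
    r = ((u : X → ℝ) x - (u : X → ℝ) y) ^ 2 / E.form u u}

theorem sq_sub_le (u : E.domain) (x y : X) :
    ((u : X → ℝ) x - (u : X → ℝ) y) ^ 2 ≤ E.resistance x y * E.form u u := by
  rcases (E.nonneg u).eq_or_lt with h | h
  · obtain ⟨r, hr⟩ := (E.eq_zero_iff u).1 h.symm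
    simp [hr, ← h]
  · rw [← div_le_iff₀ h]
    exact le_csSup (E.bddAbove_resistance x y) ⟨u, h, rfl⟩

/-- Functions of finite energy are continuous with respect to the resistance metric. -/
theorem continuous_of_mem [MetricSpace X] (hR : ∀ x y, dist x y = E.resistance x y)
    (u : E.domain) : Continuous (u : X → ℝ) := by
  rw [continuous_iff_continuousAt]
  intro x
  have h0 : Tendsto (fun y => √(dist y x * E.form u u)) (𝓝 x) (𝓝 0) := by
    have : ContinuousAt (fun y => √(dist y x * E.form u u)) x := by fun_prop
    simpa [ContinuousAt] using this
  rw [ContinuousAt, tendsto_iff_dist_tendsto_zero]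
  refine squeeze_zero (fun _ => dist_nonneg) (fun y => ?_) h0
  rw [Real.dist_eq]
  apply Real.le_sqrt_of_sq_le
  rw [sq_abs, hR]
  exact E.sq_sub_le u y x

/-- A function of finite energy as an element of `C(X)`. -/
def toCont [MetricSpace X] (hR : ∀ x y, dist x y = E.resistance x y) (u : E.domain) : C(X, ℝ) :=
  ⟨u, E.continuous_of_mem hR u⟩

/-! ### Traces on finite sets -/

/-- The quadratic form `E_V(v) = inf {E(u) : u ∈ F, u = v on V}`, the trace on the finite set `V`;
it depends only on the values of `v` on `V`. -/
def traceEnergy (V : Finset X) (v : X → ℝ) : ℝ :=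
  sInf {e : ℝ | ∃ u : E.domain, (∀ x ∈ V, (u : X → ℝ) x = v x) ∧ E.form u u = e}

/-- The bilinear form of the trace, by polarization. -/
def traceForm (V : Finset X) (v w : X → ℝ) : ℝ :=
  (E.traceEnergy V (v + w) - E.traceEnergy V (v - w)) / 4

open Classical in
/-- The conductances `c(V; p, q)`, that is, the unique symmetric numbers (zero for `p = q`) with
`E_V(v) = 1/2 ∑_{p, q ∈ V} c(V; p, q) (v(p) - v(q))²`: they are read off from the bilinear form of
the trace at the indicator functions of two different points. -/
def conductance (V : Finset X) (p q : X) : ℝ :=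
  if p = q then 0 else -E.traceForm V (Pi.single p 1) (Pi.single q 1)

/-! ### Antisymmetric functions and vector fields -/

/-- The universal derivation `(d_u f)(x, y) = f(x) - f(y)`. -/
def univDeriv (f : X → ℝ) : X → X → ℝ := fun x y => f x - f y

/-- The action `(g · v)(x, y) = (g(x) + g(y)) / 2 * v(x, y)` of functions on `X` on functions on
`X × X`. -/
def act (g : X → ℝ) (v : X → X → ℝ) : X → X → ℝ := fun x y => (g x + g y) / 2 * v x y

/-- The space of one-forms: the smallest linear space of functions on `X × X` that contains
`d_u f` for every `f ∈ F` and is stable under the action of `C(X)`. It is used on compact spaces,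
where `C_c(X) = C(X)` and `F ⊆ C(X)`. -/
def oneForms [TopologicalSpace X] : Submodule ℝ (X → X → ℝ) :=
  sInf {S | (∀ f : E.domain, univDeriv (f : X → ℝ) ∈ S) ∧
    ∀ (g : C(X, ℝ)), ∀ v ∈ S, act g v ∈ S}

theorem univDeriv_mem [TopologicalSpace X] (f : E.domain) :
    univDeriv (f : X → ℝ) ∈ E.oneForms :=
  Submodule.mem_sInf.2 fun _ hS => hS.1 f

theorem act_mem [TopologicalSpace X] (g : C(X, ℝ)) {v : X → X → ℝ} (hv : v ∈ E.oneForms) :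
    act g v ∈ E.oneForms :=
  Submodule.mem_sInf.2 fun S hS => hS.2 g v (Submodule.mem_sInf.1 hv S hS)

/-- `1/2 ∑_{p, q ∈ V} c(V; p, q) v(p, q) w(p, q)`. -/
def discreteInner (V : Finset X) (v w : X → X → ℝ) : ℝ :=
  1 / 2 * ∑ p ∈ V, ∑ q ∈ V, E.conductance V p q * v p q * w p q

/-- Along `(V m)`, the discrete scalar products of one-forms converge, and the limit is nonnegative
on the diagonal. On a compact resistance space this holds for every increasing sequence of
finite sets with dense union. -/
def DiscreteInnerConverges [TopologicalSpace X] (V : ℕ → Finset X) : Prop :=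
  (∀ v ∈ E.oneForms, ∀ w ∈ E.oneForms,
    ∃ l : ℝ, Tendsto (fun m => E.discreteInner (V m) v w) atTop (𝓝 l)) ∧
  ∀ v ∈ E.oneForms, ∀ l : ℝ, Tendsto (fun m => E.discreteInner (V m) v v) atTop (𝓝 l) → 0 ≤ l

/-- The one-forms, to be equipped with the seminorm determined by the sequence `V`. -/
def PreField [TopologicalSpace X] (_V : ℕ → Finset X) : Type _ := E.oneForms

section PreField

variable [TopologicalSpace X] (V : ℕ → Finset X)

instance : AddCommGroup (E.PreField V) := inferInstanceAs (AddCommGroup E.oneForms)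
instance : Module ℝ (E.PreField V) := inferInstanceAs (Module ℝ E.oneForms)

open Classical in
/-- The scalar product `⟨v, w⟩ = lim_m 1/2 ∑_{p, q ∈ V m} c(V m; p, q) v(p, q) w(p, q)` of one-forms
(with the value zero, should these limits not exist or not be nonnegative on the diagonal). -/
def preInner (v w : E.PreField V) : ℝ :=
  if E.DiscreteInnerConverges V then
    limUnder atTop fun m => E.discreteInner (V m) v.1 w.1
  else 0

theorem tendsto_preInner (h : E.DiscreteInnerConverges V) (v w : E.PreField V) :
    Tendsto (fun m => E.discreteInner (V m) v.1 w.1) atTop (𝓝 (E.preInner V v w)) := by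
  rw [preInner, if_pos h]
  exact tendsto_nhds_limUnder (h.1 v.1 v.2 w.1 w.2)

/-- The semi-scalar product on one-forms. -/
instance preFieldCore : PreInnerProductSpace.Core ℝ (E.PreField V) where
  inner := E.preInner V
  conj_inner_symm v w := by
    simp only [conj_trivial, preInner, discreteInner, mul_right_comm]
  re_inner_nonneg v := by
    by_cases h : E.DiscreteInnerConverges V
    · exact h.2 v.1 v.2 _ (E.tendsto_preInner V h v v)
    · simp [preInner, h]
  add_left u v w := by
    by_cases h : E.DiscreteInnerConverges V
    · refine tendsto_nhds_unique (E.tendsto_preInner V h (u + v) w) ?_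
      convert (E.tendsto_preInner V h u w).add (E.tendsto_preInner V h v w) using 2 with m
      have huv : (u + v).1 = u.1 + v.1 := rfl
      simp only [discreteInner, huv, Pi.add_apply, mul_add, add_mul, Finset.sum_add_distrib]
    · simp [preInner, h]
  smul_left u w r := by
    by_cases h : E.DiscreteInnerConverges V
    · refine tendsto_nhds_unique (E.tendsto_preInner V h (r • u) w) ?_
      convert (E.tendsto_preInner V h u w).const_mul r using 2 with m
      have hru : (r • u).1 = r • u.1 := rfl
      · simp only [discreteInner, hru, Pi.smul_apply, smul_eq_mul, Finset.mul_sum]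
        exact Finset.sum_congr rfl fun p _ => Finset.sum_congr rfl fun q _ => by ring
      · simp
    · simp [preInner, h]

instance : SeminormedAddCommGroup (E.PreField V) :=
  InnerProductSpace.Core.toSeminormedAddCommGroup (𝕜 := ℝ)

instance : InnerProductSpace ℝ (E.PreField V) :=
  InnerProductSpace.ofCore (E.preFieldCore V)

/-- The Hilbert space `H` of generalized `L²`-vector fields: the Hilbert space completion of the
one-forms (modulo one-forms of seminorm zero). -/
abbrev VectorField : Type _ := UniformSpace.Completion (E.PreField V)

/-- The gradient `∂f`, the class of `d_u f` in `H`. -/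
def grad (f : E.domain) : E.VectorField V :=
  let v : E.PreField V := ⟨univDeriv (f : X → ℝ), E.univDeriv_mem f⟩
  (v : E.VectorField V)

/-- The action `v ↦ g · v` of `C(X)` on one-forms. -/
def preAct (g : C(X, ℝ)) (v : E.PreField V) : E.PreField V := ⟨act g v.1, E.act_mem g v.2⟩

/-- The action `v ↦ g · v` of `C(X)` on `H`, the continuous extension of the action on one-forms. -/
def fieldAct (g : C(X, ℝ)) (v : E.VectorField V) : E.VectorField V :=
  UniformSpace.Completion.map (E.preAct V g) v

end PreField

/-! ### Elliptic and parabolic equations -/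

section Equations

variable [MetricSpace X] [MeasurableSpace X]

/-- The bilinear form
`Q(f, g) = ⟨a · ∂f, ∂g⟩_H - ⟨g · b, ∂f⟩_H - ⟨f · b', ∂g⟩_H - ⟨c f, g⟩_{L²}` for `f, g ∈ F`. -/
def bilin (hR : ∀ x y, dist x y = E.resistance x y) (V : ℕ → Finset X) (μ : Measure X)
    (a : C(X, ℝ)) (b b' : E.VectorField V) (c : X → ℝ) (f g : E.domain) : ℝ :=
  ⟪E.fieldAct V a (E.grad V f), E.grad V g⟫ - ⟪E.fieldAct V (E.toCont hR g) b, E.grad V f⟫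
    - ⟪E.fieldAct V (E.toCont hR f) b', E.grad V g⟫
    - ∫ x, c x * (f : X → ℝ) x * (g : X → ℝ) x ∂μ

/-- `u ∈ F` is a weak solution of `L u = f`, where `L` is the generator of the form `Q` with domain
`F`: one has `Q(u, g) = -⟨f, g⟩_{L²}` for all `g ∈ F`. -/
def IsWeakSolution (μ : Measure X) (Q : E.domain → E.domain → ℝ) (f : Lp ℝ 2 μ) (u : E.domain) :
    Prop :=
  ∀ g : E.domain, Q u g = -∫ x, f x * (g : X → ℝ) x ∂μ

/-- `u ∈ L²` belongs to the domain of the generator `L` of `(Q, F)`, and `L u = h`. -/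
def GeneratorApply (μ : Measure X) (Q : E.domain → E.domain → ℝ) (u h : Lp ℝ 2 μ) : Prop :=
  ∃ v : E.domain, u =ᵐ[μ] (v : X → ℝ) ∧ E.IsWeakSolution μ Q h v

/-- `u` is a solution of the Cauchy problem `∂_t u(t) = L u(t)`, `t > 0`, `u(0) = u₀`, where `L` is
the generator of `(Q, F)`: it is an element of `C¹((0, ∞), L²) ∩ C([0, ∞), L²)`. (The values of `u`
at negative times play no role.) -/
structure IsCauchySolution (μ : Measure X) (Q : E.domain → E.domain → ℝ) (u₀ : Lp ℝ 2 μ)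
    (u : ℝ → Lp ℝ 2 μ) : Prop where
  initial : u 0 = u₀
  continuousOn : ContinuousOn u (Set.Ici 0)
  contDiffOn : ContDiffOn ℝ 1 u (Set.Ioi 0)
  equation : ∀ t > 0, E.GeneratorApply μ Q (u t) (deriv u t)

end Equations

end ResistanceForm

/-- `μ` has the uniform lower bound `L`, a nondecreasing function `(0, ∞) → (0, ∞)`: every open ball
of radius `r > 0` has measure at least `L r`. -/
structure HasUniformLowerBound {X : Type*} [MetricSpace X] [MeasurableSpace X] (μ : Measure X)
    (L : ℝ → ℝ) : Prop where
  pos : ∀ r > 0, 0 < L r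
  mono : MonotoneOn L (Set.Ioi 0)
  le_measure_ball : ∀ x : X, ∀ r > 0, ENNReal.ofReal (L r) ≤ μ (Metric.ball x r)

/-- The constant `γ = 𝒱(M B) B` with `𝒱(s) = 2 / L(1 / (2 s))`, for `B = sup_m ‖b_m‖²`
(it is zero if `B = 0`). -/
def hardyConstant (L : ℝ → ℝ) (M B : ℝ) : ℝ := 2 / L (1 / (2 * (M * B))) * B

end

/-! The coefficients need not converge: everything follows from bounds that are uniform in `m`, and
from compactness. Write `N(f) = E(f,f) + ‖f‖²` with the norm of `L²`. Sequences bounded in `N` are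
precompact in the uniform topology (`exists_tendstoUniformly`): the resistance estimate makes them
equicontinuous of Hölder order 1/2, the lower bound on the measures of balls turns energy plus `L²`
norm into a sup bound, and Arzelà–Ascoli applies. The limit lies in `F` because trace energies on
each finite set pass to pointwise limits and a continuous function with bounded trace energies
belongs to `F`.

It remains to bound `N(u_m)`. The sup bound with radius `1/(2MB)` gives the Hardy-type estimate `‖g
· b‖² ≤ E(g,g)/M + γ‖g‖²`, hence coercivity `Q(f,f) ≥ κ N(f)` (`le_bilin_self`) and boundedness
(`abs_bilin_le`), with constants independent of `m`. In the elliptic case one tests the equation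
with `u_m`. In the parabolic case coercivity and boundedness yield a sector condition `Q(f,g)² ≤ K
Q(f,f) Q(g,g)`. A real-variable argument (`IsEvolution.mul_norm_deriv_le`) derives the smoothing
bound `‖u'(t)‖ ≤ 64K/t ‖u(0)‖`, and then `Q(v,v) = -⟨u'(t),u(t)⟩` is bounded.

All this presupposes that the scalar product of `H` is the actual limit and not its default value
zero (`discreteInnerConverges`). Harmonic extensions turn traces into bilinear forms, and the Markov
property makes conductances nonnegative. Then `F` is an algebra, limits exist for tensor weights
`h(x)k(y)`, and Stone–Weierstrass extends this to all continuous weights. -/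

namespace ResistanceForm

variable {X : Type*} (E : ResistanceForm X)

/-! ### Harmonic extensions and traces -/

theorem form_sq_le (u v : E.domain) : E.form u v ^ 2 ≤ E.form u u * E.form v v := by
  have h := LinearMap.BilinForm.apply_mul_apply_le_of_forall_zero_le E.form E.nonneg u v
  rwa [E.symm v u, ← sq] at h

theorem form_add_self (u v : E.domain) :
    E.form (u + v) (u + v) = E.form u u + 2 * E.form u v + E.form v v := by
  simp only [map_add, LinearMap.add_apply, E.symm v u]
  ring

theorem form_sub_self (u v : E.domain) :
    E.form (u - v) (u - v) = E.form u u - 2 * E.form u v + E.form v v := by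
  simp only [map_sub, LinearMap.sub_apply, E.symm v u]
  ring

/-- The constant functions as elements of `F`. -/
def constFn (r : ℝ) : E.domain := ⟨fun _ => r, E.const_mem r⟩

@[simp]
theorem constFn_apply (r : ℝ) (x : X) : (E.constFn r : X → ℝ) x = r := rfl

theorem form_constFn_self (r : ℝ) : E.form (E.constFn r) (E.constFn r) = 0 :=
  (E.eq_zero_iff _).2 ⟨r, fun _ => rfl⟩

theorem form_constFn_right (u : E.domain) (r : ℝ) : E.form u (E.constFn r) = 0 := by
  have h := E.form_sq_le u (E.constFn r)
  rw [form_constFn_self, mul_zero] at h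
  exact pow_eq_zero_iff two_ne_zero |>.1 (le_antisymm h (sq_nonneg _))

theorem form_add_constFn (u : E.domain) (r : ℝ) :
    E.form (u + E.constFn r) (u + E.constFn r) = E.form u u := by
  rw [form_add_self, form_constFn_right, form_constFn_self]
  ring

theorem tendsto_form_of_tendsto {u : ℕ → E.domain} {v : E.domain}
    (h : Tendsto (fun n => E.form (u n - v) (u n - v)) atTop (𝓝 0)) (w : E.domain) :
    Tendsto (fun n => E.form (u n) w) atTop (𝓝 (E.form v w)) := by
  have h0 : Tendsto (fun n => √(E.form (u n - v) (u n - v) * E.form w w)) atTop (𝓝 0) := by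
    simpa using (h.mul_const (E.form w w)).sqrt
  rw [tendsto_iff_dist_tendsto_zero]
  refine squeeze_zero (fun _ => dist_nonneg) (fun n => ?_) h0
  rw [Real.dist_eq]
  apply Real.le_sqrt_of_sq_le
  rw [sq_abs, ← LinearMap.sub_apply, ← map_sub]
  exact E.form_sq_le _ _

/-- Sequences of functions of finite energy which converge in energy and at one point converge
pointwise. -/
theorem eq_of_tendsto_energy {u : ℕ → E.domain} {v : E.domain} {x y : X} {r : ℝ}
    (h : Tendsto (fun n => E.form (u n - v) (u n - v)) atTop (𝓝 0))
    (hy : ∀ᶠ n in atTop, (u n : X → ℝ) y = (v : X → ℝ) y)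
    (hx : ∀ᶠ n in atTop, (u n : X → ℝ) x = r) : (v : X → ℝ) x = r := by
  have h1 : ∀ᶠ n in atTop, (r - (v : X → ℝ) x) ^ 2 ≤
      E.resistance x y * E.form (u n - v) (u n - v) := by
    filter_upwards [hy, hx] with n hy hx
    have := E.sq_sub_le (u n - v) x y
    simpa [hx, hy] using this
  have h2 := ge_of_tendsto (h.const_mul (E.resistance x y)) h1
  rw [mul_zero] at h2
  have := pow_eq_zero_iff two_ne_zero |>.1 (le_antisymm h2 (sq_nonneg _))
  linarith

/-- `h` is the harmonic extension to `X` of the restriction of `v` to `V`. -/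
structure IsHarmonicExt (V : Finset X) (v : X → ℝ) (h : E.domain) : Prop where
  eqOn : ∀ x ∈ V, (h : X → ℝ) x = v x
  form_eq_zero : ∀ φ : E.domain, (∀ x ∈ V, (φ : X → ℝ) x = 0) → E.form h φ = 0

/-- Parallelogram law: it makes minimizing sequences Cauchy, since midpoints of competitors are
competitors. -/
theorem form_half_add (u v : E.domain) :
    E.form (u - v) (u - v) = 2 * E.form u u + 2 * E.form v v
      - 4 * E.form ((1 / 2 : ℝ) • (u + v)) ((1 / 2 : ℝ) • (u + v)) := by
  simp only [map_add, map_sub, map_smul, LinearMap.add_apply, LinearMap.sub_apply,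
    LinearMap.smul_apply, smul_eq_mul, E.symm v u]
  ring

/-- Dirichlet principle: the minimizer of the energy among extensions of `v` exists by completeness,
and orthogonality is the vanishing of the first variation. -/
theorem exists_isHarmonicExt (V : Finset X) (v : X → ℝ) : ∃ h, E.IsHarmonicExt V v h := by
  rcases V.eq_empty_or_nonempty with rfl | ⟨x₀, hx₀⟩
  · exact ⟨0, by simp, by simp⟩
  set S : Set ℝ := {e | ∃ u : E.domain, (∀ x ∈ V, (u : X → ℝ) x = v x) ∧ E.form u u = e} with hS
  have hbdd : BddBelow S := ⟨0, by rintro e ⟨u, -, rfl⟩; exact E.nonneg u⟩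
  have hne : S.Nonempty := by
    obtain ⟨u, hu⟩ := E.exists_extension V v
    exact ⟨_, u, hu, rfl⟩
  have hex : ∀ n : ℕ, ∃ u : E.domain, (∀ x ∈ V, (u : X → ℝ) x = v x) ∧
      E.form u u < sInf S + 1 / (n + 1) := by
    intro n
    obtain ⟨e, ⟨u, hu, rfl⟩, he⟩ := exists_lt_of_csInf_lt hne
      (show sInf S < sInf S + 1 / ((n : ℝ) + 1) by linarith [Nat.one_div_pos_of_nat (α := ℝ) (n := n)])
    exact ⟨u, hu, he⟩
  choose u hu hlt using hex
  have hle : ∀ w : E.domain, (∀ x ∈ V, (w : X → ℝ) x = v x) → sInf S ≤ E.form w w :=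
    fun w hw => csInf_le hbdd ⟨w, hw, rfl⟩
  have htend : Tendsto (fun n : ℕ => 1 / ((n : ℝ) + 1)) atTop (𝓝 0) :=
    tendsto_one_div_add_atTop_nhds_zero_nat
  have hcauchy : ∀ ε > 0, ∃ N, ∀ m ≥ N, ∀ n ≥ N, E.form (u m - u n) (u m - u n) < ε := by
    intro ε hε
    obtain ⟨N, hN⟩ := eventually_atTop.1 (htend.eventually (gt_mem_nhds (show 0 < ε / 4 by linarith)))
    refine ⟨N, fun m hm n hn => ?_⟩
    rw [form_half_add]
    have h1 := hle ((1 / 2 : ℝ) • (u m + u n)) fun x hx => by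
      simp [hu m x hx, hu n x hx]; ring
    linarith [hlt m, hlt n, hN m hm, hN n hn]
  obtain ⟨w, hw⟩ := E.complete u hcauchy
  -- Energy determines the limit only up to a constant; the constant is fixed by the value at `x₀`.
  set h : E.domain := w + E.constFn (v x₀ - (w : X → ℝ) x₀) with hh
  have hconv : Tendsto (fun n => E.form (u n - h) (u n - h)) atTop (𝓝 0) := by
    refine hw.congr fun n => ?_
    rw [hh, ← E.form_add_constFn (u n - (w + E.constFn _)) (v x₀ - (w : X → ℝ) x₀)]
    congr 2 <;> abel_nf
  have hx₀' : (h : X → ℝ) x₀ = v x₀ := by simp [hh]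
  refine ⟨h, fun x hx => E.eq_of_tendsto_energy (y := x₀) hconv
    (.of_forall fun n => by rw [hx₀', hu n x₀ hx₀]) (.of_forall fun n => hu n x hx), ?_⟩
  intro φ hφ
  have hen : Tendsto (fun n => E.form (u n) (u n)) atTop (𝓝 (sInf S)) := by
    refine tendsto_of_tendsto_of_tendsto_of_le_of_le tendsto_const_nhds
      (by simpa using htend.const_add (sInf S)) (fun n => hle _ (hu n)) (fun n => (hlt n).le)
  have hquad : ∀ t : ℝ, 0 ≤ 2 * t * E.form h φ + t ^ 2 * E.form φ φ := by
    intro t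
    have h1 : ∀ n, sInf S ≤ E.form (u n) (u n) + 2 * (t * E.form (u n) φ) + t ^ 2 * E.form φ φ := by
      intro n
      have := hle (u n + t • φ) fun x hx => by simp [hφ x hx, hu n x hx]
      rw [form_add_self] at this
      simp only [map_smul, LinearMap.smul_apply, smul_eq_mul] at this
      linarith
    have h2 := ge_of_tendsto ((hen.add (((E.tendsto_form_of_tendsto hconv φ).const_mul t).const_mul
      2)).add_const (t ^ 2 * E.form φ φ)) (.of_forall h1)
    linarith
  have hB := E.nonneg φ
  by_contra hne0
  -- A near-optimal parameter; the `+ 1` keeps the denominator positive when `φ` has zero energy.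
  have h1 := hquad (-(E.form h φ) / (E.form φ φ + 1))
  have h2 : 2 * (-(E.form h φ) / (E.form φ φ + 1)) * E.form h φ +
      (-(E.form h φ) / (E.form φ φ + 1)) ^ 2 * E.form φ φ =
      - (E.form h φ ^ 2 * (E.form φ φ + 2) / (E.form φ φ + 1) ^ 2) := by
    field_simp
    ring
  rw [h2] at h1
  have : 0 < E.form h φ ^ 2 * (E.form φ φ + 2) / (E.form φ φ + 1) ^ 2 := by positivity
  linarith

variable {E}

namespace IsHarmonicExt

variable {V : Finset X} {v w : X → ℝ} {h k : E.domain}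

theorem add (hh : E.IsHarmonicExt V v h) (hk : E.IsHarmonicExt V w k) :
    E.IsHarmonicExt V (v + w) (h + k) :=
  ⟨fun x hx => by simp [hh.eqOn x hx, hk.eqOn x hx],
    fun φ hφ => by simp [hh.form_eq_zero φ hφ, hk.form_eq_zero φ hφ]⟩

theorem sub (hh : E.IsHarmonicExt V v h) (hk : E.IsHarmonicExt V w k) :
    E.IsHarmonicExt V (v - w) (h - k) :=
  ⟨fun x hx => by simp [hh.eqOn x hx, hk.eqOn x hx],
    fun φ hφ => by simp [hh.form_eq_zero φ hφ, hk.form_eq_zero φ hφ]⟩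

theorem form_eq_of_eqOn (hh : E.IsHarmonicExt V v h) {u u' : E.domain}
    (hu : ∀ x ∈ V, (u : X → ℝ) x = (u' : X → ℝ) x) : E.form h u = E.form h u' := by
  have := hh.form_eq_zero (u - u') fun x hx => by simp [hu x hx]
  rw [map_sub] at this
  linarith

/-- Pythagoras: the difference of two extensions vanishes on `V` and is therefore orthogonal to `h`.
-/
theorem form_eq_add (hh : E.IsHarmonicExt V v h) {u : E.domain}
    (hu : ∀ x ∈ V, (u : X → ℝ) x = v x) :
    E.form u u = E.form h h + E.form (u - h) (u - h) := by
  have := hh.form_eq_of_eqOn (u := u) (u' := h) fun x hx => (hu x hx).trans (hh.eqOn x hx).symm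
  rw [form_sub_self, E.symm u h, this]
  ring

theorem traceEnergy_eq (hh : E.IsHarmonicExt V v h) : E.traceEnergy V v = E.form h h := by
  refine le_antisymm (csInf_le ⟨0, by rintro e ⟨u, -, rfl⟩; exact E.nonneg u⟩ ⟨h, hh.eqOn, rfl⟩)
    (le_csInf ⟨_, h, hh.eqOn, rfl⟩ ?_)
  rintro e ⟨u, hu, rfl⟩
  rw [hh.form_eq_add hu]
  linarith [E.nonneg (u - h)]

/-- Harmonic extension is additive, so polarizing the trace polarizes `E`. This is the source of the
bilinearity of the trace. -/
theorem traceForm_eq (hh : E.IsHarmonicExt V v h) (hk : E.IsHarmonicExt V w k) :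
    E.traceForm V v w = E.form h k := by
  rw [traceForm, (hh.add hk).traceEnergy_eq, (hh.sub hk).traceEnergy_eq, form_add_self,
    form_sub_self]
  ring

end IsHarmonicExt

/-! ### Conductances and the discrete scalar product -/

variable (E)

theorem traceEnergy_le (V : Finset X) (u : E.domain) : E.traceEnergy V u ≤ E.form u u :=
  csInf_le ⟨0, by rintro e ⟨u, -, rfl⟩; exact E.nonneg u⟩ ⟨u, fun _ _ => rfl, rfl⟩

theorem traceForm_self (V : Finset X) (v : X → ℝ) : E.traceForm V v v = E.traceEnergy V v := by
  obtain ⟨h, hh⟩ := E.exists_isHarmonicExt V v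
  rw [hh.traceForm_eq hh, hh.traceEnergy_eq]

theorem traceForm_comm (V : Finset X) (v w : X → ℝ) : E.traceForm V v w = E.traceForm V w v := by
  obtain ⟨h, hh⟩ := E.exists_isHarmonicExt V v
  obtain ⟨k, hk⟩ := E.exists_isHarmonicExt V w
  rw [hh.traceForm_eq hk, hk.traceForm_eq hh, E.symm]

theorem traceForm_const_right (V : Finset X) (v : X → ℝ) (r : ℝ) :
    E.traceForm V v (fun _ => r) = 0 := by
  obtain ⟨h, hh⟩ := E.exists_isHarmonicExt V v
  have hk : E.IsHarmonicExt V (fun _ => r) (E.constFn r) :=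
    ⟨fun _ _ => rfl, fun φ _ => by rw [E.symm, form_constFn_right]⟩
  rw [hh.traceForm_eq hk, form_constFn_right]

open Classical in
/-- The Gram matrix of the trace. -/
noncomputable def traceEntry (V : Finset X) (p q : X) : ℝ := E.traceForm V (Pi.single p 1) (Pi.single q 1)

-- A linear combination of the harmonic extensions of indicators is the harmonic extension of the
-- combination.
open Classical in
theorem sum_traceEntry (V : Finset X) (v w : X → ℝ) :
    ∑ p ∈ V, ∑ q ∈ V, E.traceEntry V p q * (v p * w q) = E.traceForm V v w := by
  choose h hh using fun p : X => E.exists_isHarmonicExt V (Pi.single p (1 : ℝ))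
  have key : ∀ v : X → ℝ, E.IsHarmonicExt V v (∑ p ∈ V, v p • h p) := by
    intro v
    constructor
    · intro x hx
      have : ∀ p ∈ V, v p * (h p : X → ℝ) x = if p = x then v p else 0 := by
        intro p _
        rw [(hh p).eqOn x hx, Pi.single_apply]
        simp [eq_comm]
      simp [Finset.sum_apply, Finset.sum_congr rfl this, hx]
    · intro φ hφ
      simp [(hh _).form_eq_zero φ hφ]
  rw [(key v).traceForm_eq (key w)]
  simp only [map_sum, LinearMap.sum_apply, map_smul, LinearMap.smul_apply, smul_eq_mul]
  rw [Finset.sum_comm]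
  refine Finset.sum_congr rfl fun q _ => ?_
  rw [Finset.mul_sum]
  refine Finset.sum_congr rfl fun p _ => ?_
  rw [traceEntry, (hh p).traceForm_eq (hh q)]
  ring

-- This is the Markov property: subtracting a small multiple of `k` from `h` and truncating gives
-- another extension of the indicator of `p`, which cannot have less energy than `h`. The inequality
-- at first order in `t` is the claim.
open Classical in
theorem traceEntry_nonpos (V : Finset X) {p q : X} (hpq : p ≠ q) : E.traceEntry V p q ≤ 0 := by
  obtain ⟨h, hh⟩ := E.exists_isHarmonicExt V (Pi.single p (1 : ℝ))
  obtain ⟨k, hk⟩ := E.exists_isHarmonicExt V (Pi.single q (1 : ℝ))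
  rw [traceEntry, hh.traceForm_eq hk]
  have key : ∀ t > 0, 2 * E.form h k ≤ t * E.form k k := by
    intro t ht
    obtain ⟨hmem, hle⟩ := E.markov (h - t • k)
    -- On `V`, `h - t • k` equals `1` at `p`, `-t` at `q` and `0` elsewhere; truncation to `[0, 1]`
    -- only changes the value at `q`, to `0`.
    have h1 := hh.form_eq_add (u := ⟨_, hmem⟩) fun x hx => by
      simp only [Submodule.coe_sub, Submodule.coe_smul, Pi.sub_apply, Pi.smul_apply, smul_eq_mul,
        hh.eqOn x hx, hk.eqOn x hx, Pi.single_apply]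
      by_cases hxp : x = p
      · subst hxp; simp [hpq]
      · by_cases hxq : x = q
        · subst hxq
          simp only [hxp, if_false, if_true]
          rw [min_eq_right (by linarith), max_eq_left (by linarith)]
        · simp [hxp, hxq]
    rw [form_sub_self] at hle
    simp only [map_smul, LinearMap.smul_apply, smul_eq_mul] at hle
    have h2 := E.nonneg (⟨_, hmem⟩ - h)
    have : t * (2 * E.form h k) ≤ t * (t * E.form k k) := by linarith
    exact le_of_mul_le_mul_left this ht
  have hlim : Tendsto (fun t : ℝ => t * E.form k k) (𝓝[>] 0) (𝓝 0) := by
    have : Tendsto (fun t : ℝ => t * E.form k k) (𝓝 0) (𝓝 (0 * E.form k k)) :=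
      (continuous_id.mul continuous_const).tendsto 0
    rw [zero_mul] at this
    exact this.mono_left nhdsWithin_le_nhds
  have := ge_of_tendsto hlim (eventually_mem_nhdsWithin.mono fun t ht => key t ht)
  linarith

theorem conductance_of_ne (V : Finset X) {p q : X} (h : p ≠ q) :
    E.conductance V p q = -E.traceEntry V p q := by
  simp [conductance, traceEntry, h]

theorem conductance_nonneg (V : Finset X) (p q : X) : 0 ≤ E.conductance V p q := by
  by_cases h : p = q
  · simp [conductance, h]
  · rw [E.conductance_of_ne V h]
    linarith [E.traceEntry_nonpos V h]

/-- The diagonal entries of the Gram matrix differ from the conductances, but a kernel vanishing on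
the diagonal does not see them. -/
theorem sum_conductance_mul (V : Finset X) {K : X → X → ℝ} (hK : ∀ p, K p p = 0) :
    ∑ p ∈ V, ∑ q ∈ V, E.conductance V p q * K p q
      = -∑ p ∈ V, ∑ q ∈ V, E.traceEntry V p q * K p q := by
  simp only [← Finset.sum_neg_distrib]
  refine Finset.sum_congr rfl fun p _ => Finset.sum_congr rfl fun q _ => ?_
  by_cases h : p = q
  · simp [h, hK]
  · rw [E.conductance_of_ne V h, neg_mul]

/-- The discrete integral of `1/2 h(x) k(y) (f(x) - f(y)) (g(x) - g(y))` in terms of traces. -/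
theorem discreteInner_tensor (V : Finset X) (h k f g : X → ℝ) :
    E.discreteInner V (fun x y => h x * k y * (f x - f y)) (univDeriv g)
      = -(1 / 2) * (E.traceForm V (h * f * g) k - E.traceForm V (h * f) (k * g)
        - E.traceForm V (h * g) (k * f) + E.traceForm V h (k * f * g)) := by
  -- The kernel expands into four products of a function of `x` and a function of `y`, each of which
  -- sums to a trace.
  have h1 := E.sum_conductance_mul V
    (K := fun x y => h x * k y * (f x - f y) * (g x - g y)) (by simp)
  rw [discreteInner]
  simp only [univDeriv, mul_assoc] at h1 ⊢
  rw [h1]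
  simp only [← E.sum_traceEntry, ← Finset.sum_sub_distrib, ← Finset.sum_add_distrib, Pi.mul_apply]
  rw [mul_neg, neg_mul]
  congr 2
  refine Finset.sum_congr rfl fun p _ => Finset.sum_congr rfl fun q _ => ?_
  ring

/-- The tensor formula with `h = k = 1`; two of the four traces vanish because constants have no
energy. -/
theorem discreteInner_univDeriv (V : Finset X) (f g : X → ℝ) :
    E.discreteInner V (univDeriv f) (univDeriv g) = E.traceForm V f g := by
  have h := E.discreteInner_tensor V (fun _ => 1) (fun _ => 1) f g
  have e1 : (fun _ : X => (1 : ℝ)) * f = f := by ext; simp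
  have e2 : (fun _ : X => (1 : ℝ)) * g = g := by ext; simp
  rw [e1, e2, traceForm_const_right, E.traceForm_comm V (fun _ => 1), traceForm_const_right,
    E.traceForm_comm V g f] at h
  have e3 : (fun x y => (fun _ : X => (1 : ℝ)) x * (fun _ : X => (1 : ℝ)) y * (f x - f y))
      = univDeriv f := by
    ext x y; simp [univDeriv]
  rw [e3] at h
  rw [h]
  ring

theorem discreteInner_mono {V : Finset X} {v w : X → X → ℝ}
    (h : ∀ x y, v x y ^ 2 ≤ w x y ^ 2) : E.discreteInner V v v ≤ E.discreteInner V w w := by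
  refine mul_le_mul_of_nonneg_left (Finset.sum_le_sum fun p _ => Finset.sum_le_sum fun q _ => ?_)
    (by norm_num)
  simp only [mul_assoc]
  exact mul_le_mul_of_nonneg_left (by simpa [sq] using h p q) (E.conductance_nonneg V p q)

theorem discreteInner_self_nonneg (V : Finset X) (v : X → X → ℝ) : 0 ≤ E.discreteInner V v v := by
  refine mul_nonneg (by norm_num) (Finset.sum_nonneg fun p _ => Finset.sum_nonneg fun q _ => ?_)
  rw [mul_assoc]
  exact mul_nonneg (E.conductance_nonneg V p q) (mul_self_nonneg _)

end ResistanceForm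

namespace ResistanceForm

variable {X : Type*} (E : ResistanceForm X)

/-! ### Exhaustion by finite sets -/

theorem traceEnergy_mono {V W : Finset X} (h : V ⊆ W) (w : X → ℝ) :
    E.traceEnergy V w ≤ E.traceEnergy W w := by
  obtain ⟨k, hk⟩ := E.exists_isHarmonicExt W w
  rw [hk.traceEnergy_eq]
  exact csInf_le ⟨0, by rintro e ⟨u, -, rfl⟩; exact E.nonneg u⟩
    ⟨k, fun x hx => hk.eqOn x (h hx), rfl⟩

/-- A continuous function whose traces along an exhausting sequence of finite sets have bounded
energies has finite energy, and its energy is the limit of the energies of the traces. -/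
theorem exists_eq_of_traceEnergy_le [Nonempty X] [MetricSpace X]
    (hR : ∀ x y, dist x y = E.resistance x y) {V : ℕ → Finset X} (hV : Monotone V)
    (hVd : Dense (⋃ m, (V m : Set X))) {w : X → ℝ} (hw : Continuous w) {C : ℝ}
    (hC : ∀ m, E.traceEnergy (V m) w ≤ C) :
    ∃ u : E.domain, (u : X → ℝ) = w ∧
      Tendsto (fun m => E.traceEnergy (V m) w) atTop (𝓝 (E.form u u)) := by
  choose h hh using fun m => E.exists_isHarmonicExt (V m) w
  have hmono : Monotone fun m => E.traceEnergy (V m) w :=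
    fun m n hmn => E.traceEnergy_mono (hV hmn) w
  have hlim := tendsto_atTop_ciSup hmono ⟨C, by rintro _ ⟨m, rfl⟩; exact hC m⟩
  -- By Pythagoras the squared distances of harmonic extensions are increments of a bounded monotone
  -- sequence, so the extensions are Cauchy in energy.
  have hdiff : ∀ m n, m ≤ n → E.form (h n - h m) (h n - h m) =
      E.traceEnergy (V n) w - E.traceEnergy (V m) w := by
    intro m n hmn
    have := (hh m).form_eq_add (u := h n) fun x hx => (hh n).eqOn x (hV hmn hx)
    rw [(hh n).traceEnergy_eq, (hh m).traceEnergy_eq]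
    linarith
  have hswap : ∀ u v : E.domain, E.form (u - v) (u - v) = E.form (v - u) (v - u) := by
    intro u v
    rw [form_sub_self, form_sub_self, E.symm u v]
    ring
  have hcauchy : ∀ ε > 0, ∃ N, ∀ m ≥ N, ∀ n ≥ N, E.form (h m - h n) (h m - h n) < ε := by
    intro ε hε
    obtain ⟨N, hN⟩ := Metric.cauchySeq_iff.1 hlim.cauchySeq ε hε
    refine ⟨N, fun m hm n hn => ?_⟩
    have key := hN m hm n hn
    rw [Real.dist_eq] at key
    rcases le_total m n with hmn | hmn
    · rw [hswap, hdiff m n hmn]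
      exact (le_abs_self _).trans_lt (by rwa [abs_sub_comm])
    · rw [hdiff n m hmn]
      exact (le_abs_self _).trans_lt key
  obtain ⟨v, hv⟩ := E.complete h hcauchy
  obtain ⟨x₀, hx₀⟩ := hVd.nonempty
  obtain ⟨m₀, hm₀⟩ := Set.mem_iUnion.1 hx₀
  set u : E.domain := v + E.constFn (w x₀ - (v : X → ℝ) x₀) with hu
  have hconv : Tendsto (fun n => E.form (h n - u) (h n - u)) atTop (𝓝 0) := by
    refine hv.congr fun n => ?_
    rw [hu, ← E.form_add_constFn (h n - (v + E.constFn _)) (w x₀ - (v : X → ℝ) x₀)]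
    congr 2 <;> abel_nf
  have hev : ∀ m, ∀ x ∈ V m, ∀ᶠ n in atTop, (h n : X → ℝ) x = w x := fun m x hx =>
    eventually_atTop.2 ⟨m, fun n hn => (hh n).eqOn x (hV hn hx)⟩
  have hux₀ : (u : X → ℝ) x₀ = w x₀ := by simp [hu]
  have huw : (u : X → ℝ) = w := by
    refine Continuous.ext_on hVd (E.continuous_of_mem hR u) hw fun x hx => ?_
    obtain ⟨m, hm⟩ := Set.mem_iUnion.1 hx
    exact E.eq_of_tendsto_energy hconv (by rw [hux₀]; exact hev m₀ x₀ hm₀) (hev m x hm)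
  refine ⟨u, huw, ?_⟩
  have h1 : ∀ n, E.traceEnergy (V n) w = E.form u u - E.form (h n - u) (h n - u) := by
    intro n
    have := (hh n).form_eq_add (u := u) fun x _ => by rw [huw]
    rw [(hh n).traceEnergy_eq, hswap]
    linarith
  simpa [h1] using hconv.const_sub (E.form u u)

theorem tendsto_traceEnergy [Nonempty X] [MetricSpace X]
    (hR : ∀ x y, dist x y = E.resistance x y) {V : ℕ → Finset X} (hV : Monotone V)
    (hVd : Dense (⋃ m, (V m : Set X))) (u : E.domain) :
    Tendsto (fun m => E.traceEnergy (V m) u) atTop (𝓝 (E.form u u)) := by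
  obtain ⟨u', hu', h⟩ := E.exists_eq_of_traceEnergy_le hR hV hVd (E.continuous_of_mem hR u)
    (fun m => E.traceEnergy_le (V m) u)
  rwa [Subtype.ext hu'] at h

theorem tendsto_traceForm [Nonempty X] [MetricSpace X]
    (hR : ∀ x y, dist x y = E.resistance x y) {V : ℕ → Finset X} (hV : Monotone V)
    (hVd : Dense (⋃ m, (V m : Set X))) (u v : E.domain) :
    Tendsto (fun m => E.traceForm (V m) u v) atTop (𝓝 (E.form u v)) := by
  have h := ((E.tendsto_traceEnergy hR hV hVd (u + v)).sub
    (E.tendsto_traceEnergy hR hV hVd (u - v))).div_const 4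
  rw [form_add_self, form_sub_self] at h
  have e : E.form u v = (E.form u u + 2 * E.form u v + E.form v v
      - (E.form u u - 2 * E.form u v + E.form v v)) / 4 := by ring
  rw [e]
  exact h

/-- On a compact resistance space the functions of finite energy form an algebra. -/
theorem mul_mem [Nonempty X] [MetricSpace X] [CompactSpace X]
    (hR : ∀ x y, dist x y = E.resistance x y) {V : ℕ → Finset X} (hV : Monotone V)
    (hVd : Dense (⋃ m, (V m : Set X))) {f g : X → ℝ} (hf : f ∈ E.domain) (hg : g ∈ E.domain) :
    f * g ∈ E.domain := by
  set f' := E.toCont hR ⟨f, hf⟩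
  set g' := E.toCont hR ⟨g, hg⟩
  have hfb : ∀ x, |f x| ≤ ‖f'‖ := fun x => f'.norm_coe_le_norm x
  have hgb : ∀ x, |g x| ≤ ‖g'‖ := fun x => g'.norm_coe_le_norm x
  have hbound : ∀ m, E.traceEnergy (V m) (f * g) ≤
      E.form ⟨f, hf⟩ ⟨f, hf⟩ * (2 * ‖g'‖ ^ 2) + E.form ⟨g, hg⟩ ⟨g, hg⟩ * (2 * ‖f'‖ ^ 2) := by
    intro m
    -- Since conductances are nonnegative, the Leibniz rule can be applied pair by pair.
    have h1 : E.traceEnergy (V m) (f * g) ≤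
        E.traceEnergy (V m) f * (2 * ‖g'‖ ^ 2) + E.traceEnergy (V m) g * (2 * ‖f'‖ ^ 2) := by
      simp only [← traceForm_self, ← discreteInner_univDeriv, discreteInner, Finset.mul_sum,
        Finset.sum_mul, ← Finset.sum_add_distrib]
      refine Finset.sum_le_sum fun p _ => Finset.sum_le_sum fun q _ => ?_
      have hc := E.conductance_nonneg (V m) p q
      have h2 : (f p * g p - f q * g q) ^ 2 ≤
          (f p - f q) ^ 2 * (2 * ‖g'‖ ^ 2) + (g p - g q) ^ 2 * (2 * ‖f'‖ ^ 2) := by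
        have e : f p * g p - f q * g q = (f p - f q) * g p + f q * (g p - g q) := by ring
        have h3 : g p ^ 2 ≤ ‖g'‖ ^ 2 := sq_le_sq' (by linarith [(abs_le.1 (hgb p)).1]) (abs_le.1 (hgb p)).2
        have h4 : f q ^ 2 ≤ ‖f'‖ ^ 2 := sq_le_sq' (by linarith [(abs_le.1 (hfb q)).1]) (abs_le.1 (hfb q)).2
        have h5 := mul_le_mul_of_nonneg_left h3 (sq_nonneg (f p - f q))
        have h6 := mul_le_mul_of_nonneg_left h4 (sq_nonneg (g p - g q))
        rw [e]
        nlinarith [sq_nonneg ((f p - f q) * g p - f q * (g p - g q))]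
      have h7 := mul_le_mul_of_nonneg_left h2 hc
      simp only [univDeriv, Pi.mul_apply]
      linarith
    refine h1.trans (add_le_add ?_ ?_)
    · exact mul_le_mul_of_nonneg_right (E.traceEnergy_le (V m) ⟨f, hf⟩) (by positivity)
    · exact mul_le_mul_of_nonneg_right (E.traceEnergy_le (V m) ⟨g, hg⟩) (by positivity)
  obtain ⟨u, hu, -⟩ := E.exists_eq_of_traceEnergy_le hR hV hVd (w := f * g)
    ((E.continuous_of_mem hR ⟨f, hf⟩).mul (E.continuous_of_mem hR ⟨g, hg⟩)) hbound
  rw [← hu]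
  exact u.2

/-! ### Convergence of the discrete scalar products -/

/-- The four traces involve only products of elements of `F`, which lie in `F`, and trace forms
converge there. -/
theorem tendsto_discreteInner_tensor [Nonempty X] [MetricSpace X] [CompactSpace X]
    (hR : ∀ x y, dist x y = E.resistance x y) {V : ℕ → Finset X} (hV : Monotone V)
    (hVd : Dense (⋃ m, (V m : Set X))) (h k f g : E.domain) :
    ∃ l, Tendsto (fun m => E.discreteInner (V m)
      (fun x y => (h : X → ℝ) x * (k : X → ℝ) y * ((f : X → ℝ) x - (f : X → ℝ) y))
      (univDeriv g)) atTop (𝓝 l) := by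
  have hm : ∀ {f g : X → ℝ}, f ∈ E.domain → g ∈ E.domain → f * g ∈ E.domain :=
    fun hf hg => E.mul_mem hR hV hVd hf hg
  have T := E.tendsto_traceForm hR hV hVd
  simp only [discreteInner_tensor]
  exact ⟨_, ((((T ⟨_, hm (hm h.2 f.2) g.2⟩ k).sub (T ⟨_, hm h.2 f.2⟩ ⟨_, hm k.2 g.2⟩)).sub
    (T ⟨_, hm h.2 g.2⟩ ⟨_, hm k.2 f.2⟩)).add (T h ⟨_, hm (hm k.2 f.2) g.2⟩)).const_mul _⟩

/-- Functions of the form `h(x) k(y)` with `h` and `k` of finite energy. -/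
def tensorSubmonoid [Nonempty X] [MetricSpace X] [CompactSpace X]
    (hR : ∀ x y, dist x y = E.resistance x y) {V : ℕ → Finset X} (hV : Monotone V)
    (hVd : Dense (⋃ m, (V m : Set X))) : Submonoid C(X × X, ℝ) where
  carrier := {G | ∃ h k : E.domain, ∀ z, G z = (h : X → ℝ) z.1 * (k : X → ℝ) z.2}
  mul_mem' := by
    rintro G G' ⟨h, k, hG⟩ ⟨h', k', hG'⟩
    refine ⟨⟨_, E.mul_mem hR hV hVd h.2 h'.2⟩, ⟨_, E.mul_mem hR hV hVd k.2 k'.2⟩, fun z => ?_⟩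
    simp only [ContinuousMap.mul_apply, hG, hG', Pi.mul_apply]
    ring
  one_mem' := ⟨E.constFn 1, E.constFn 1, fun z => by simp⟩

theorem exists_ne_of_ne {x y : X} (h : x ≠ y) :
    ∃ u : E.domain, (u : X → ℝ) x ≠ (u : X → ℝ) y := by
  classical
  obtain ⟨u, hu⟩ := E.exists_extension {x, y} (Pi.single x 1)
  refine ⟨u, ?_⟩
  rw [hu x (by simp), hu y (by simp)]
  simp [h.symm]

/-- The bound does not depend on `V`, so uniform approximation of the weight commutes with the limit
over the finite sets. -/
theorem abs_discreteInner_sub_le (V : Finset X) {G G' : X → X → ℝ} {ε : ℝ}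
    (h : ∀ x y, |G x y - G' x y| ≤ ε) (f g : E.domain) :
    |E.discreteInner V (fun x y => G x y * ((f : X → ℝ) x - (f : X → ℝ) y)) (univDeriv g)
      - E.discreteInner V (fun x y => G' x y * ((f : X → ℝ) x - (f : X → ℝ) y)) (univDeriv g)|
      ≤ ε * (E.form f f + E.form g g) := by
  rcases isEmpty_or_nonempty X with hX | ⟨⟨x₀⟩⟩
  · have : V = ∅ := Finset.eq_empty_of_isEmpty V
    subst this
    have h1 : ∀ u : E.domain, E.form u u = 0 := fun u => (E.eq_zero_iff u).2 ⟨0, fun x => hX.elim x⟩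
    simp [discreteInner, h1]
  have hε : 0 ≤ ε := (abs_nonneg _).trans (h x₀ x₀)
  have hle : ∀ u : E.domain, E.discreteInner V (univDeriv u) (univDeriv u) ≤ E.form u u := by
    intro u
    rw [discreteInner_univDeriv, traceForm_self]
    exact E.traceEnergy_le V u
  refine le_trans ?_ (mul_le_mul_of_nonneg_left (add_le_add (hle f) (hle g)) hε)
  simp only [discreteInner, ← mul_sub, ← Finset.sum_sub_distrib, ← mul_add,
    ← Finset.sum_add_distrib]
  rw [abs_mul, abs_of_pos (show (0 : ℝ) < 1 / 2 by norm_num), mul_left_comm]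
  refine mul_le_mul_of_nonneg_left ?_ (by norm_num)
  rw [Finset.mul_sum]
  refine (Finset.abs_sum_le_sum_abs _ _).trans (Finset.sum_le_sum fun p _ => ?_)
  rw [Finset.mul_sum]
  refine (Finset.abs_sum_le_sum_abs _ _).trans (Finset.sum_le_sum fun q _ => ?_)
  have hc := E.conductance_nonneg V p q
  have e : E.conductance V p q * (G p q * ((f : X → ℝ) p - (f : X → ℝ) q)) * univDeriv g p q
      - E.conductance V p q * (G' p q * ((f : X → ℝ) p - (f : X → ℝ) q)) * univDeriv g p q
      = E.conductance V p q * ((G p q - G' p q) *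
        (((f : X → ℝ) p - (f : X → ℝ) q) * ((g : X → ℝ) p - (g : X → ℝ) q))) := by
    simp only [univDeriv]; ring
  rw [e, abs_mul, abs_of_nonneg hc, abs_mul]
  have h2 : |((f : X → ℝ) p - (f : X → ℝ) q) * ((g : X → ℝ) p - (g : X → ℝ) q)| ≤
      ((f : X → ℝ) p - (f : X → ℝ) q) ^ 2 + ((g : X → ℝ) p - (g : X → ℝ) q) ^ 2 := by
    rw [abs_le]
    constructor <;> nlinarith [sq_nonneg (((f : X → ℝ) p - (f : X → ℝ) q) -
      ((g : X → ℝ) p - (g : X → ℝ) q)), sq_nonneg (((f : X → ℝ) p - (f : X → ℝ) q) +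
      ((g : X → ℝ) p - (g : X → ℝ) q)), sq_nonneg ((f : X → ℝ) p - (f : X → ℝ) q),
      sq_nonneg ((g : X → ℝ) p - (g : X → ℝ) q)]
  have h3 := mul_le_mul_of_nonneg_left (mul_le_mul (h p q) h2 (abs_nonneg _) hε) hc
  refine h3.trans (le_of_eq ?_)
  simp only [univDeriv]
  ring

/-- The discrete scalar products converge if weighted by a continuous function on `X × X`. -/
theorem tendsto_discreteInner_weighted [Nonempty X] [MetricSpace X] [CompactSpace X]
    (hR : ∀ x y, dist x y = E.resistance x y) {V : ℕ → Finset X} (hV : Monotone V)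
    (hVd : Dense (⋃ m, (V m : Set X))) (G : C(X × X, ℝ)) (f g : E.domain) :
    ∃ l, Tendsto (fun m => E.discreteInner (V m)
      (fun x y => G (x, y) * ((f : X → ℝ) x - (f : X → ℝ) y)) (univDeriv g)) atTop (𝓝 l) := by
  set A : Subalgebra ℝ C(X × X, ℝ) := Algebra.adjoin ℝ (E.tensorSubmonoid hR hV hVd) with hA
  have hsep : A.SeparatesPoints := by
    rintro ⟨x, y⟩ ⟨x', y'⟩ hne
    by_cases hx : x = x'
    · have hy : y ≠ y' := fun h => hne (by rw [hx, h])
      obtain ⟨u, hu⟩ := E.exists_ne_of_ne hy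
      refine ⟨_, ⟨(E.toCont hR u).comp ⟨Prod.snd, continuous_snd⟩, Algebra.subset_adjoin
        ⟨E.constFn 1, u, fun z => ?_⟩, rfl⟩, hu⟩
      simp [toCont]
    · obtain ⟨u, hu⟩ := E.exists_ne_of_ne hx
      refine ⟨_, ⟨(E.toCont hR u).comp ⟨Prod.fst, continuous_fst⟩, Algebra.subset_adjoin
        ⟨u, E.constFn 1, fun z => ?_⟩, rfl⟩, hu⟩
      simp [toCont]
  have hconv : ∀ H ∈ A, ∃ l, Tendsto (fun m => E.discreteInner (V m)
      (fun x y => H (x, y) * ((f : X → ℝ) x - (f : X → ℝ) y)) (univDeriv g)) atTop (𝓝 l) := by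
    intro H hH
    -- Tensors are closed under multiplication, so the algebra they generate is their linear span
    -- and no product case arises.
    rw [← Subalgebra.mem_toSubmodule, hA, Algebra.adjoin_eq_span, Submonoid.closure_eq] at hH
    induction hH using Submodule.span_induction with
    | mem H hH =>
      obtain ⟨h, k, hH⟩ := hH
      simpa only [hH] using E.tendsto_discreteInner_tensor hR hV hVd h k f g
    | zero => exact ⟨0, by simp [discreteInner]⟩
    | add H H' _ _ h h' =>
      obtain ⟨l, hl⟩ := h
      obtain ⟨l', hl'⟩ := h'
      refine ⟨l + l', (hl.add hl').congr fun m => ?_⟩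
      simp only [discreteInner, ContinuousMap.add_apply, ← mul_add, ← Finset.sum_add_distrib,
        ← add_mul]
    | smul r H _ h =>
      obtain ⟨l, hl⟩ := h
      refine ⟨r * l, (hl.const_mul r).congr fun m => ?_⟩
      simp only [discreteInner, ContinuousMap.smul_apply, smul_eq_mul, Finset.mul_sum]
      exact Finset.sum_congr rfl fun p _ => Finset.sum_congr rfl fun q _ => by ring
  apply cauchySeq_tendsto_of_complete
  rw [Metric.cauchySeq_iff]
  intro ε hε
  -- The `+ 1` permits division by `K` when both energies vanish.
  set K := E.form f f + E.form g g + 1 with hK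
  have hKpos : 0 < K := by linarith [E.nonneg f, E.nonneg g]
  obtain ⟨H, hH⟩ := ContinuousMap.exists_mem_subalgebra_near_continuousMap_of_separatesPoints A hsep
    G (ε / (3 * K)) (by positivity)
  have hGH : ∀ x y, |G (x, y) - (H : C(X × X, ℝ)) (x, y)| ≤ ε / (3 * K) := by
    intro x y
    rw [abs_sub_comm]
    exact (((H : C(X × X, ℝ)) - G).norm_coe_le_norm (x, y)).trans hH.le
  obtain ⟨l, hl⟩ := hconv H H.2
  obtain ⟨N, hN⟩ := Metric.cauchySeq_iff.1 hl.cauchySeq (ε / 3) (by positivity)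
  refine ⟨N, fun m hm n hn => ?_⟩
  have h1 := E.abs_discreteInner_sub_le (V m) hGH f g
  have h2 := E.abs_discreteInner_sub_le (V n) hGH f g
  have h3 := hN m hm n hn
  have h4 : ε / (3 * K) * (E.form f f + E.form g g) < ε / 3 := by
    rw [div_mul_eq_mul_div, div_lt_div_iff₀ (by positivity) (by norm_num)]
    nlinarith
  rw [Real.dist_eq] at h3 ⊢
  rw [abs_lt] at h3 ⊢
  rw [abs_le] at h1 h2
  constructor <;> linarith

/-- The linear span of the functions `G(x, y) (f(x) - f(y))`, with `G` continuous and `f` of finite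
energy. -/
def weightedDeriv [TopologicalSpace X] : Submodule ℝ (X → X → ℝ) :=
  Submodule.span ℝ {v | ∃ (G : C(X × X, ℝ)) (f : E.domain),
    v = fun x y => G (x, y) * ((f : X → ℝ) x - (f : X → ℝ) y)}

/-- The span is stable under the action because `(g(x) + g(y)) / 2` is itself a continuous weight on
`X × X`; minimality of the one-forms does the rest. -/
theorem oneForms_le_weightedDeriv [TopologicalSpace X] : E.oneForms ≤ E.weightedDeriv := by
  refine sInf_le ⟨fun f => Submodule.subset_span ⟨1, f, by ext; simp [univDeriv]⟩, ?_⟩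
  intro g v hv
  induction hv using Submodule.span_induction with
  | mem v hv =>
    obtain ⟨G, f, rfl⟩ := hv
    refine Submodule.subset_span ⟨⟨fun z => (g z.1 + g z.2) / 2, by fun_prop⟩ * G, f, ?_⟩
    ext x y
    simp [act, mul_assoc]
  | zero => convert E.weightedDeriv.zero_mem; ext; simp [act]
  | add v w _ _ h h' => convert E.weightedDeriv.add_mem h h' using 1; ext; simp [act, mul_add]
  | smul r v _ h =>
    convert E.weightedDeriv.smul_mem r h using 1
    ext
    simp [act, mul_left_comm]

/-- The product of two weights is a weight, so the scalar product of two generators reduces to a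
single weighted one. -/
theorem discreteInnerConverges [Nonempty X] [MetricSpace X] [CompactSpace X]
    (hR : ∀ x y, dist x y = E.resistance x y) {V : ℕ → Finset X} (hV : Monotone V)
    (hVd : Dense (⋃ m, (V m : Set X))) : E.DiscreteInnerConverges V := by
  refine ⟨fun v hv w hw => ?_, fun v _ l hl =>
    ge_of_tendsto' hl fun m => E.discreteInner_self_nonneg (V m) v⟩
  replace hv := E.oneForms_le_weightedDeriv hv
  replace hw := E.oneForms_le_weightedDeriv hw
  induction hv, hw using Submodule.span_induction₂ with
  | mem_mem v w hv hw =>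
    obtain ⟨G, f, rfl⟩ := hv
    obtain ⟨G', f', rfl⟩ := hw
    obtain ⟨l, hl⟩ := E.tendsto_discreteInner_weighted hR hV hVd (G * G') f f'
    refine ⟨l, hl.congr fun m => ?_⟩
    simp only [discreteInner, ContinuousMap.mul_apply, univDeriv]
    congr 1
    exact Finset.sum_congr rfl fun p _ => Finset.sum_congr rfl fun q _ => by ring
  | zero_left w _ => exact ⟨0, by simp [discreteInner]⟩
  | zero_right v _ => exact ⟨0, by simp [discreteInner]⟩
  | add_left v v' w _ _ _ h h' =>
    obtain ⟨l, hl⟩ := h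
    obtain ⟨l', hl'⟩ := h'
    refine ⟨l + l', (hl.add hl').congr fun m => ?_⟩
    simp only [discreteInner, Pi.add_apply, ← mul_add, ← Finset.sum_add_distrib, ← add_mul]
  | add_right v w w' _ _ _ h h' =>
    obtain ⟨l, hl⟩ := h
    obtain ⟨l', hl'⟩ := h'
    refine ⟨l + l', (hl.add hl').congr fun m => ?_⟩
    simp only [discreteInner, Pi.add_apply, ← mul_add, ← Finset.sum_add_distrib]
  | smul_left r v w _ _ h =>
    obtain ⟨l, hl⟩ := h
    refine ⟨r * l, (hl.const_mul r).congr fun m => ?_⟩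
    simp only [discreteInner, Pi.smul_apply, smul_eq_mul, Finset.mul_sum]
    exact Finset.sum_congr rfl fun p _ => Finset.sum_congr rfl fun q _ => by ring
  | smul_right r v w _ _ h =>
    obtain ⟨l, hl⟩ := h
    refine ⟨r * l, (hl.const_mul r).congr fun m => ?_⟩
    simp only [discreteInner, Pi.smul_apply, smul_eq_mul, Finset.mul_sum]
    exact Finset.sum_congr rfl fun p _ => Finset.sum_congr rfl fun q _ => by ring

end ResistanceForm

namespace ResistanceForm

variable {X : Type*} (E : ResistanceForm X)

/-! ### Vector fields -/

section VectorField

/-- The function `d_u f` as a one-form. -/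
noncomputable def preGrad [TopologicalSpace X] (V : ℕ → Finset X) (f : E.domain) : E.PreField V :=
  ⟨univDeriv (f : X → ℝ), E.univDeriv_mem f⟩

theorem grad_eq_coe [TopologicalSpace X] (V : ℕ → Finset X) (f : E.domain) :
    E.grad V f = (E.preGrad V f : E.VectorField V) := rfl

theorem grad_add [TopologicalSpace X] (V : ℕ → Finset X) (f g : E.domain) :
    E.grad V (f + g) = E.grad V f + E.grad V g := by
  simp only [grad_eq_coe, ← UniformSpace.Completion.coe_add]
  congr 1
  refine Subtype.ext ?_
  ext x y
  exact add_sub_add_comm _ _ _ _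

theorem grad_smul [TopologicalSpace X] (V : ℕ → Finset X) (r : ℝ) (f : E.domain) :
    E.grad V (r • f) = r • E.grad V f := by
  simp only [grad_eq_coe, ← UniformSpace.Completion.coe_smul]
  congr 1
  refine Subtype.ext ?_
  ext x y
  exact (mul_sub _ _ _).symm

theorem continuous_fieldAct [TopologicalSpace X] (V : ℕ → Finset X) (g : C(X, ℝ)) :
    Continuous (E.fieldAct V g) :=
  UniformSpace.Completion.continuous_map

/-- Averages of `g` are at most `‖g‖` in modulus, and nonnegative conductances carry the pointwise
bound to each discrete norm. -/
theorem norm_preAct_le [Nonempty X] [MetricSpace X] [CompactSpace X] {V : ℕ → Finset X}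
    (hV : E.DiscreteInnerConverges V) (g : C(X, ℝ)) (v : E.PreField V) :
    ‖E.preAct V g v‖ ≤ ‖g‖ * ‖v‖ := by
  have h1 : ⟪E.preAct V g v, E.preAct V g v⟫ ≤ ‖g‖ ^ 2 * ⟪v, v⟫ := by
    refine le_of_tendsto_of_tendsto' (E.tendsto_preInner V hV _ _)
      ((E.tendsto_preInner V hV v v).const_mul _) fun m => ?_
    have h2 : E.discreteInner (V m) (E.preAct V g v).1 (E.preAct V g v).1 ≤
        E.discreteInner (V m) (‖g‖ • v.1) (‖g‖ • v.1) := by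
      refine E.discreteInner_mono fun x y => ?_
      have hx := abs_le.1 (g.norm_coe_le_norm x)
      have hy := abs_le.1 (g.norm_coe_le_norm y)
      simp only [preAct, act, Pi.smul_apply, smul_eq_mul, mul_pow]
      refine mul_le_mul_of_nonneg_right ?_ (sq_nonneg _)
      exact sq_le_sq' (by linarith) (by linarith)
    refine h2.trans (le_of_eq ?_)
    simp only [discreteInner, Pi.smul_apply, smul_eq_mul, Finset.mul_sum]
    exact Finset.sum_congr rfl fun p _ => Finset.sum_congr rfl fun q _ => by ring
  rw [real_inner_self_eq_norm_sq, real_inner_self_eq_norm_sq, ← mul_pow] at h1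
  exact le_of_sq_le_sq h1 (by positivity)

theorem preAct_sub [TopologicalSpace X] (V : ℕ → Finset X) (g : C(X, ℝ)) (v w : E.PreField V) :
    E.preAct V g (v - w) = E.preAct V g v - E.preAct V g w :=
  Subtype.ext (by
    ext x y
    exact mul_sub ((g x + g y) / 2) (v.1 x y) (w.1 x y))

variable [Nonempty X] [MetricSpace X] [CompactSpace X] {V : ℕ → Finset X}

/-- Uniform continuity is what makes `UniformSpace.Completion.map` an extension of the action. -/
theorem uniformContinuous_preAct (hV : E.DiscreteInnerConverges V) (g : C(X, ℝ)) :
    UniformContinuous (E.preAct V g) := by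
  refine (LipschitzWith.of_dist_le_mul (K := ⟨‖g‖, norm_nonneg g⟩) fun v w => ?_).uniformContinuous
  rw [dist_eq_norm, dist_eq_norm, ← preAct_sub]
  exact E.norm_preAct_le hV g _

theorem fieldAct_coe (hV : E.DiscreteInnerConverges V) (g : C(X, ℝ)) (v : E.PreField V) :
    E.fieldAct V g (v : E.VectorField V) = (E.preAct V g v : E.VectorField V) :=
  UniformSpace.Completion.map_coe (E.uniformContinuous_preAct hV g) v

theorem norm_fieldAct_le (hV : E.DiscreteInnerConverges V) (g : C(X, ℝ)) (v : E.VectorField V) :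
    ‖E.fieldAct V g v‖ ≤ ‖g‖ * ‖v‖ := by
  induction v using UniformSpace.Completion.induction_on with
  | hp =>
    exact isClosed_le (E.continuous_fieldAct V g).norm (continuous_const.mul continuous_norm)
  | ih v =>
    rw [E.fieldAct_coe hV, UniformSpace.Completion.norm_coe, UniformSpace.Completion.norm_coe]
    exact E.norm_preAct_le hV g v

theorem fieldAct_add_left (hV : E.DiscreteInnerConverges V) (g g' : C(X, ℝ))
    (v : E.VectorField V) : E.fieldAct V (g + g') v = E.fieldAct V g v + E.fieldAct V g' v := by
  induction v using UniformSpace.Completion.induction_on with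
  | hp =>
    exact isClosed_eq (E.continuous_fieldAct V _)
      ((E.continuous_fieldAct V _).add (E.continuous_fieldAct V _))
  | ih v =>
    simp only [E.fieldAct_coe hV, ← UniformSpace.Completion.coe_add]
    congr 1
    refine Subtype.ext ?_
    ext x y
    show ((g x + g' x) + (g y + g' y)) / 2 * v.1 x y =
      (g x + g y) / 2 * v.1 x y + (g' x + g' y) / 2 * v.1 x y
    ring

theorem fieldAct_smul_left (hV : E.DiscreteInnerConverges V) (r : ℝ) (g : C(X, ℝ))
    (v : E.VectorField V) : E.fieldAct V (r • g) v = r • E.fieldAct V g v := by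
  induction v using UniformSpace.Completion.induction_on with
  | hp => exact isClosed_eq (E.continuous_fieldAct V _) ((E.continuous_fieldAct V _).const_smul r)
  | ih v =>
    simp only [E.fieldAct_coe hV, ← UniformSpace.Completion.coe_smul]
    congr 1
    refine Subtype.ext ?_
    ext x y
    show (r * g x + r * g y) / 2 * v.1 x y = r * ((g x + g y) / 2 * v.1 x y)
    ring

theorem fieldAct_add_right (hV : E.DiscreteInnerConverges V) (g : C(X, ℝ))
    (v w : E.VectorField V) : E.fieldAct V g (v + w) = E.fieldAct V g v + E.fieldAct V g w := by
  induction v, w using UniformSpace.Completion.induction_on₂ with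
  | hp =>
    exact isClosed_eq ((E.continuous_fieldAct V g).comp (continuous_fst.add continuous_snd))
      (((E.continuous_fieldAct V g).comp continuous_fst).add
        ((E.continuous_fieldAct V g).comp continuous_snd))
  | ih v w =>
    simp only [E.fieldAct_coe hV, ← UniformSpace.Completion.coe_add]
    congr 1
    refine Subtype.ext ?_
    ext x y
    exact mul_add ((g x + g y) / 2) (v.1 x y) (w.1 x y)

theorem fieldAct_smul_right (hV : E.DiscreteInnerConverges V) (g : C(X, ℝ)) (r : ℝ)
    (v : E.VectorField V) : E.fieldAct V g (r • v) = r • E.fieldAct V g v := by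
  induction v using UniformSpace.Completion.induction_on with
  | hp =>
    exact isClosed_eq ((E.continuous_fieldAct V g).comp (continuous_const_smul r))
      ((E.continuous_fieldAct V g).const_smul r)
  | ih v =>
    simp only [E.fieldAct_coe hV, ← UniformSpace.Completion.coe_smul]
    congr 1
    refine Subtype.ext ?_
    ext x y
    exact mul_left_comm ((g x + g y) / 2) r (v.1 x y)

theorem norm_grad_sq (hR : ∀ x y, dist x y = E.resistance x y) (hVm : Monotone V)
    (hVd : Dense (⋃ m, (V m : Set X))) (f : E.domain) : ‖E.grad V f‖ ^ 2 = E.form f f := by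
  have hV := E.discreteInnerConverges hR hVm hVd
  rw [grad_eq_coe, UniformSpace.Completion.norm_coe, ← real_inner_self_eq_norm_sq]
  refine tendsto_nhds_unique (E.tendsto_preInner V hV _ _) ?_
  simp only [preGrad, discreteInner_univDeriv, traceForm_self]
  exact E.tendsto_traceEnergy hR hVm hVd f

theorem le_inner_fieldAct_grad (hR : ∀ x y, dist x y = E.resistance x y) (hVm : Monotone V)
    (hVd : Dense (⋃ m, (V m : Set X))) {a : C(X, ℝ)} {lam : ℝ} (ha : ∀ x, lam ≤ a x)
    (f : E.domain) : lam * E.form f f ≤ ⟪E.fieldAct V a (E.grad V f), E.grad V f⟫ := by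
  have hV := E.discreteInnerConverges hR hVm hVd
  rw [grad_eq_coe, E.fieldAct_coe hV, UniformSpace.Completion.inner_coe]
  refine le_of_tendsto_of_tendsto' ((E.tendsto_traceEnergy hR hVm hVd f).const_mul lam)
    (E.tendsto_preInner V hV _ _) fun m => ?_
  rw [← traceForm_self, ← discreteInner_univDeriv, discreteInner, discreteInner, mul_left_comm,
    Finset.mul_sum]
  refine mul_le_mul_of_nonneg_left (Finset.sum_le_sum fun p _ => ?_) (by norm_num)
  rw [Finset.mul_sum]
  refine Finset.sum_le_sum fun q _ => ?_
  have h1 := mul_nonneg (E.conductance_nonneg (V m) p q)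
    (mul_self_nonneg (univDeriv (f : X → ℝ) p q))
  have h2 := mul_le_mul_of_nonneg_right (show lam ≤ (a p + a q) / 2 by linarith [ha p, ha q]) h1
  simp only [preAct, preGrad, act]
  linarith

end VectorField

/-! ### The sup norm, the energy and the norm in `L²` -/

section Sup

variable [MetricSpace X] [CompactSpace X] [MeasurableSpace X] [BorelSpace X]

theorem integrable_sq (hR : ∀ x y, dist x y = E.resistance x y) (μ : Measure X)
    [IsFiniteMeasure μ] (g : E.domain) : Integrable (fun x => (g : X → ℝ) x ^ 2) μ :=
  ((E.continuous_of_mem hR g).pow 2).integrable_of_hasCompactSupport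
    (HasCompactSupport.of_compactSpace _)

/-- On the ball of radius `r` about `x`, `g(x)² ≤ 2 g(y)² + 2 r E(g,g)` by the resistance estimate;
integrate over `y` in the ball and divide by the lower bound on its measure. -/
theorem sq_le_energy (hR : ∀ x y, dist x y = E.resistance x y) (μ : Measure X)
    [IsFiniteMeasure μ] {L : ℝ → ℝ} (hL : HasUniformLowerBound μ L) {r : ℝ} (hr : 0 < r)
    (g : E.domain) (x : X) :
    (g : X → ℝ) x ^ 2 ≤ 2 / L r * (∫ y, (g : X → ℝ) y ^ 2 ∂μ) + 2 * r * E.form g g := by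
  set B := Metric.ball x r
  have hint := E.integrable_sq hR μ g
  set k : ℝ := (g : X → ℝ) x ^ 2 - 2 * r * E.form g g with hk
  have hLr := hL.pos r hr
  have hI : 0 ≤ ∫ y, (g : X → ℝ) y ^ 2 ∂μ := integral_nonneg fun y => sq_nonneg _
  have hball : L r ≤ μ.real B := by
    rw [Measure.real, ← ENNReal.ofReal_le_iff_le_toReal (measure_ne_top μ B)]
    exact hL.le_measure_ball x r hr
  suffices h : k * L r ≤ 2 * ∫ y, (g : X → ℝ) y ^ 2 ∂μ by
    have : k ≤ 2 / L r * ∫ y, (g : X → ℝ) y ^ 2 ∂μ := by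
      rw [div_mul_eq_mul_div, le_div_iff₀ hLr]
      exact h
    linarith
  -- The ball bound can be multiplied by `k` only if `k` is nonnegative; otherwise the claim is
  -- trivial.
  rcases le_or_gt k 0 with hk0 | hk0
  · nlinarith
  have hpt : ∀ y ∈ B, k ≤ 2 * (g : X → ℝ) y ^ 2 := by
    intro y hy
    have h1 := E.sq_sub_le g y x
    rw [← hR] at h1
    have h2 := mul_le_mul_of_nonneg_right (Metric.mem_ball.1 hy).le (E.nonneg g)
    nlinarith [sq_nonneg ((g : X → ℝ) x - 2 * (g : X → ℝ) y)]
  calc k * L r ≤ k * μ.real B := mul_le_mul_of_nonneg_left hball hk0.le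
    _ = ∫ _ in B, k ∂μ := by rw [setIntegral_const, smul_eq_mul, mul_comm]
    _ ≤ ∫ y in B, 2 * (g : X → ℝ) y ^ 2 ∂μ :=
        setIntegral_mono_on (integrable_const _).integrableOn
          (hint.const_mul 2).integrableOn Metric.isOpen_ball.measurableSet hpt
    _ ≤ ∫ y, 2 * (g : X → ℝ) y ^ 2 ∂μ :=
        setIntegral_le_integral (hint.const_mul 2) (.of_forall fun y => by positivity)
    _ = 2 * ∫ y, (g : X → ℝ) y ^ 2 ∂μ := integral_const_mul _ _

theorem norm_toCont_sq_le [Nonempty X] (hR : ∀ x y, dist x y = E.resistance x y) (μ : Measure X)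
    [IsFiniteMeasure μ] {L : ℝ → ℝ} (hL : HasUniformLowerBound μ L) {r : ℝ} (hr : 0 < r)
    (g : E.domain) :
    ‖E.toCont hR g‖ ^ 2 ≤ 2 / L r * (∫ y, (g : X → ℝ) y ^ 2 ∂μ) + 2 * r * E.form g g := by
  have h0 : 0 ≤ 2 / L r * (∫ y, (g : X → ℝ) y ^ 2 ∂μ) + 2 * r * E.form g g :=
    (sq_nonneg _).trans (E.sq_le_energy hR μ hL hr g (Classical.arbitrary X))
  rw [← Real.le_sqrt (norm_nonneg _) h0, ContinuousMap.norm_le _ (Real.sqrt_nonneg _)]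
  intro x
  apply Real.le_sqrt_of_sq_le
  rw [Real.norm_eq_abs, sq_abs]
  exact E.sq_le_energy hR μ hL hr g x

end Sup

end ResistanceForm

/-! ### Evolution equations for sectorial forms -/

section Evolution

variable {F H : Type*} [AddCommGroup F] [Module ℝ F] [NormedAddCommGroup H] [InnerProductSpace ℝ H]

/-- `φ` solves `φ' = L φ` on `(0, ∞)`, where `L` is the generator of the form `Q` with domain
`F`, included in `H` by `J`. -/
structure IsEvolution (J : F →ₗ[ℝ] H) (Q : F →ₗ[ℝ] F →ₗ[ℝ] ℝ) (φ φ' : ℝ → H) : Prop where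
  hasDerivAt : ∀ t > 0, HasDerivAt φ (φ' t) t
  equation : ∀ t > 0, ∃ v, J v = φ t ∧ ∀ g, Q v g = -⟪φ' t, J g⟫

namespace IsEvolution

variable {J : F →ₗ[ℝ] H} {Q : F →ₗ[ℝ] F →ₗ[ℝ] ℝ} {φ φ' ψ ψ' : ℝ → H} {K : ℝ}

theorem sub (h : IsEvolution J Q φ φ') (k : IsEvolution J Q ψ ψ') :
    IsEvolution J Q (fun t => φ t - ψ t) (fun t => φ' t - ψ' t) where
  hasDerivAt t ht := (h.hasDerivAt t ht).sub (k.hasDerivAt t ht)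
  equation t ht := by
    obtain ⟨v, hv, hv'⟩ := h.equation t ht
    obtain ⟨w, hw, hw'⟩ := k.equation t ht
    refine ⟨v - w, by rw [map_sub, hv, hw], fun g => ?_⟩
    rw [map_sub, LinearMap.sub_apply, hv', hw', inner_sub_left]
    ring

theorem smul (h : IsEvolution J Q φ φ') (r : ℝ) :
    IsEvolution J Q (fun t => r • φ t) (fun t => r • φ' t) where
  hasDerivAt t ht := (h.hasDerivAt t ht).const_smul r
  equation t ht := by
    obtain ⟨v, hv, hv'⟩ := h.equation t ht
    refine ⟨r • v, by rw [map_smul, hv], fun g => ?_⟩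
    rw [map_smul, LinearMap.smul_apply, hv', real_inner_smul_left, smul_eq_mul]
    ring

theorem shift (h : IsEvolution J Q φ φ') {s : ℝ} (hs : 0 ≤ s) :
    IsEvolution J Q (fun t => φ (t + s)) (fun t => φ' (t + s)) where
  hasDerivAt t ht := (h.hasDerivAt (t + s) (by linarith)).comp_add_const t s
  equation t ht := h.equation (t + s) (by linarith)

theorem hasDerivAt_norm_sq (h : IsEvolution J Q φ φ') {t : ℝ} (ht : 0 < t) :
    HasDerivAt (fun t => ‖φ t‖ ^ 2) (2 * ⟪φ t, φ' t⟫) t :=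
  (h.hasDerivAt t ht).norm_sq

theorem inner_deriv_nonpos (h : IsEvolution J Q φ φ') (hQ : ∀ f, 0 ≤ Q f f) {t : ℝ} (ht : 0 < t) :
    ⟪φ t, φ' t⟫ ≤ 0 := by
  obtain ⟨v, hv, hv'⟩ := h.equation t ht
  have h1 := hQ v
  rw [hv', hv, real_inner_comm] at h1
  linarith

theorem norm_antitone (h : IsEvolution J Q φ φ') (hQ : ∀ f, 0 ≤ Q f f) {s t : ℝ} (hs : 0 < s)
    (hst : s ≤ t) : ‖φ t‖ ≤ ‖φ s‖ := by
  have key : AntitoneOn (fun t => ‖φ t‖ ^ 2) (Set.Ioi 0) := by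
    refine antitoneOn_of_deriv_nonpos (convex_Ioi 0)
      (fun t ht => (h.hasDerivAt_norm_sq ht).continuousAt.continuousWithinAt)
      (fun t ht => ?_) (fun t ht => ?_) <;> rw [interior_Ioi] at ht
    · exact (h.hasDerivAt_norm_sq ht).differentiableAt.differentiableWithinAt
    · rw [(h.hasDerivAt_norm_sq ht).deriv]
      linarith [h.inner_deriv_nonpos hQ ht]
  exact le_of_sq_le_sq (key hs (hs.trans_le hst) hst) (norm_nonneg _)

/-- The sector condition makes solutions Hölder continuous of order `1/2`. -/
theorem norm_sub_sq_le_inner (h : IsEvolution J Q φ φ')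
    (hQ : ∀ f, 0 ≤ Q f f) (hK : 0 ≤ K) (hsec : ∀ f g, Q f g ^ 2 ≤ K * (Q f f * Q g g))
    {t s : ℝ} (ht : 0 < t) (hs : 0 ≤ s) :
    ‖φ (t + s) - φ t‖ ^ 2 ≤ K / 2 * s * -⟪φ t, φ' t⟫ := by
  obtain ⟨v, hv, hv'⟩ := h.equation t ht
  -- The claim says that this function of `r`, which vanishes at `0`, is nonnegative; it is in fact
  -- monotone.
  have hd : ∀ r ≥ 0, HasDerivAt (fun r => K / 2 * -⟪φ t, φ' t⟫ * r - ‖φ (t + r) - φ t‖ ^ 2)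
      (K / 2 * -⟪φ t, φ' t⟫ * 1 - 2 * ⟪φ (t + r) - φ t, φ' (t + r)⟫) r := by
    intro r hr
    have h1 : HasDerivAt (fun r => φ (t + r) - φ t) (φ' (t + r)) r :=
      ((h.hasDerivAt (t + r) (by linarith)).comp_const_add t r).sub_const _
    exact ((hasDerivAt_id r).const_mul _).sub h1.norm_sq
  have hmono : MonotoneOn (fun r => K / 2 * -⟪φ t, φ' t⟫ * r - ‖φ (t + r) - φ t‖ ^ 2)
      (Set.Ici 0) := by
    refine monotoneOn_of_deriv_nonneg (convex_Ici 0)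
      (fun r hr => (hd r hr).continuousAt.continuousWithinAt)
      (fun r hr => ?_) (fun r hr => ?_) <;> rw [interior_Ici] at hr
    · exact (hd r hr.le).differentiableAt.differentiableWithinAt
    rw [(hd r hr.le).deriv]
    obtain ⟨w, hw, hw'⟩ := h.equation (t + r) (add_pos ht hr)
    have e1 : ⟪φ (t + r) - φ t, φ' (t + r)⟫ = -(Q w w - Q w v) := by
      rw [hw', hw', hw, hv, inner_sub_left, real_inner_comm, real_inner_comm (φ t)]
      ring
    have e2 : -⟪φ t, φ' t⟫ = Q v v := by rw [hv', hv, real_inner_comm]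
    rw [e1, e2]
    -- Sector condition and the inequality of arithmetic and geometric means: `K Q(w,w) Q(v,v) ≤
    -- (Q(w,w) + K/4 Q(v,v))²`.
    have h3 : Q w v ≤ Q w w + K / 4 * Q v v := by
      refine le_of_abs_le (abs_le_of_sq_le_sq ?_ ?_)
      · nlinarith [hsec w v, sq_nonneg (Q w w - K / 4 * Q v v)]
      · have := mul_nonneg hK (hQ v)
        linarith [hQ w]
    linarith
  have h2 := hmono (Set.mem_Ici.2 le_rfl) (Set.mem_Ici.2 hs) hs
  simp only [add_zero, sub_self, norm_zero, mul_zero] at h2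
  linarith

/-- The dissipation `-⟨φ,φ'⟩` integrates to at most `‖φ(a)‖²/2` over `(a, b)`, so at some
intermediate time it is at most the average. The Hölder bound from that time carries over to `b`,
because the increment is itself an evolution and its norm decreases. -/
theorem norm_sub_sq_le (h : IsEvolution J Q φ φ')
    (hQ : ∀ f, 0 ≤ Q f f) (hK : 0 ≤ K) (hsec : ∀ f g, Q f g ^ 2 ≤ K * (Q f f * Q g g))
    {a b s : ℝ} (ha : 0 < a) (hab : a < b) (hs : 0 ≤ s) :
    (b - a) * ‖φ (b + s) - φ b‖ ^ 2 ≤ K / 4 * s * ‖φ a‖ ^ 2 := by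
  obtain ⟨t, ⟨hat, htb⟩, ht⟩ := exists_hasDerivAt_eq_slope (fun t => ‖φ t‖ ^ 2)
    (fun t => 2 * ⟪φ t, φ' t⟫) hab
    (fun t ht => (h.hasDerivAt_norm_sq (ha.trans_le ht.1)).continuousAt.continuousWithinAt)
    (fun t ht => h.hasDerivAt_norm_sq (ha.trans ht.1))
  have hba : 0 < b - a := by linarith
  rw [eq_div_iff hba.ne'] at ht
  have ht0 : 0 < t := ha.trans hat
  have h1 := ((h.shift hs).sub h).norm_antitone hQ ht0 htb.le
  have h2 := h.norm_sub_sq_le_inner hQ hK hsec ht0 hs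
  have h3 : ‖φ (b + s) - φ b‖ ^ 2 ≤ ‖φ (t + s) - φ t‖ ^ 2 := by gcongr
  have h4 : (b - a) * -⟪φ t, φ' t⟫ ≤ ‖φ a‖ ^ 2 / 2 := by
    nlinarith [sq_nonneg ‖φ b‖]
  calc (b - a) * ‖φ (b + s) - φ b‖ ^ 2 ≤ (b - a) * (K / 2 * s * -⟪φ t, φ' t⟫) :=
        mul_le_mul_of_nonneg_left (h3.trans h2) hba.le
    _ = K / 2 * s * ((b - a) * -⟪φ t, φ' t⟫) := by ring
    _ ≤ K / 2 * s * (‖φ a‖ ^ 2 / 2) := mul_le_mul_of_nonneg_left h4 (by positivity)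
    _ = K / 4 * s * ‖φ a‖ ^ 2 := by ring

/-- Difference quotients of an evolution are evolutions; apply the previous estimate to them and
pass to the limit. No second derivative in time is needed. -/
theorem norm_deriv_sub_sq_le (h : IsEvolution J Q φ φ')
    (hQ : ∀ f, 0 ≤ Q f f) (hK : 0 ≤ K) (hsec : ∀ f g, Q f g ^ 2 ≤ K * (Q f f * Q g g))
    {a b s : ℝ} (ha : 0 < a) (hab : a < b) (hs : 0 ≤ s) :
    (b - a) * ‖φ' (b + s) - φ' b‖ ^ 2 ≤ K / 4 * s * ‖φ' a‖ ^ 2 := by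
  have hb : 0 < b := ha.trans hab
  have hslope : ∀ t > 0, Tendsto (fun r : ℝ => r⁻¹ • (φ (t + r) - φ t)) (𝓝[>] 0) (𝓝 (φ' t)) :=
    fun t ht => (h.hasDerivAt t ht).tendsto_slope_zero_right
  refine le_of_tendsto_of_tendsto ((((hslope (b + s) (by linarith)).sub
    (hslope b hb)).norm.pow 2).const_mul (b - a)) (((hslope a ha).norm.pow 2).const_mul _)
    (eventually_mem_nhdsWithin.mono fun r hr => ?_)
  exact (((h.shift (le_of_lt hr)).sub h).smul r⁻¹).norm_sub_sq_le hQ hK hsec ha hab hs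

/-- On a short interval after `b` the derivative is nearly constant, so `φ'(b)` is controlled by an
increment of `φ`, up to a small multiple of `‖φ'(a)‖`. -/
theorem norm_deriv_step (h : IsEvolution J Q φ φ')
    (hQ : ∀ f, 0 ≤ Q f f) (hK : 1 ≤ K) (hsec : ∀ f g, Q f g ^ 2 ≤ K * (Q f f * Q g g))
    {a b : ℝ} (ha : 0 < a) (hab : a < b) :
    (b - a) * ‖φ' b‖ ≤ 8 * K * ‖φ a‖ + (b - a) / 4 * ‖φ' a‖ := by
  have hba : 0 < b - a := by linarith
  have hb : 0 < b := ha.trans hab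
  -- This length makes the oscillation of `φ'` at most `‖φ'(a)‖ / 4`.
  set s := (b - a) / (4 * K) with hs
  have hspos : 0 < s := by positivity
  have h1 : ∀ r ∈ Set.Ico 0 s, ‖φ' (b + r) - φ' b‖ ≤ 1 / 4 * ‖φ' a‖ := by
    intro r hr
    have h2 := h.norm_deriv_sub_sq_le hQ (by linarith) hsec ha hab hr.1
    have h3 : K / 4 * r * ‖φ' a‖ ^ 2 ≤ (b - a) * (1 / 4 * ‖φ' a‖) ^ 2 := by
      have h4 : K / 4 * r ≤ K / 4 * s := mul_le_mul_of_nonneg_left hr.2.le (by positivity)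
      have h5 : K / 4 * s = (b - a) / 16 := by rw [hs]; field_simp; norm_num
      have := mul_le_mul_of_nonneg_right (h4.trans h5.le) (sq_nonneg ‖φ' a‖)
      linarith
    exact le_of_sq_le_sq (le_of_mul_le_mul_left (h2.trans h3) hba) (by positivity)
  have hd : ∀ r ∈ Set.Icc 0 s, HasDerivWithinAt (fun r => φ (b + r) - r • φ' b)
      (φ' (b + r) - φ' b) (Set.Icc 0 s) r := by
    intro r hr
    have h2 := ((h.hasDerivAt (b + r) (by linarith [hr.1])).comp_const_add b r).sub
      ((hasDerivAt_id r).smul_const (φ' b))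
    rw [one_smul] at h2
    exact h2.hasDerivWithinAt
  have h2 := norm_image_sub_le_of_norm_deriv_le_segment' hd h1 s ⟨hspos.le, le_rfl⟩
  simp only [add_zero, zero_smul, sub_zero] at h2
  have h3 : ‖s • φ' b‖ ≤ ‖φ (b + s)‖ + ‖φ b‖ + 1 / 4 * ‖φ' a‖ * s := by
    have e : s • φ' b = φ (b + s) - φ b - (φ (b + s) - s • φ' b - φ b) := by abel
    rw [e]
    refine (norm_sub_le _ _).trans ?_
    linarith [norm_sub_le (φ (b + s)) (φ b)]
  rw [norm_smul, Real.norm_of_nonneg hspos.le] at h3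
  have h4 := h.norm_antitone hQ ha hab.le
  have h5 := h.norm_antitone hQ ha (show a ≤ b + s by linarith)
  have h6 : b - a = 4 * K * s := by rw [hs]; field_simp
  rw [h6]
  nlinarith [mul_le_mul_of_nonneg_left (h3.trans (add_le_add_left (add_le_add h5 h4) _))
    (show 0 ≤ 4 * K by linarith)]

/-- The smoothing property of the semigroup associated with a sectorial form. -/
theorem mul_norm_deriv_le (h : IsEvolution J Q φ φ') (hφ' : ContinuousOn φ' (Set.Ioi 0))
    (hQ : ∀ f, 0 ≤ Q f f) (hK : 1 ≤ K) (hsec : ∀ f g, Q f g ^ 2 ≤ K * (Q f f * Q g g))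
    {δ t : ℝ} (hδ : 0 < δ) (hδt : δ ≤ t) : (t - δ) * ‖φ' t‖ ≤ 32 * K * ‖φ δ‖ := by
  have hcont : ContinuousOn (fun s => (s - δ) * ‖φ' s‖) (Set.Icc δ t) :=
    (continuousOn_id.sub continuousOn_const).mul
      (hφ'.mono fun s hs => hδ.trans_le hs.1).norm
  -- The weight `s - δ` allows absorption: a step from the midpoint of `δ` and a maximal point `s`
  -- bounds half of the maximum by `8 K ‖φ δ‖` plus a quarter of the maximum, whence the factor 32.
  -- Keeping `δ` positive avoids a possible singularity of `φ'` at `0`.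
  obtain ⟨s, hs, hmax⟩ := isCompact_Icc.exists_isMaxOn (Set.nonempty_Icc.2 hδt) hcont
  refine (hmax (Set.right_mem_Icc.2 hδt)).trans ?_
  have hN : 0 ≤ K * ‖φ δ‖ := by positivity
  rcases hs.1.eq_or_lt with rfl | hlt
  · simp only [sub_self, zero_mul]
    linarith
  have h1 := h.norm_deriv_step hQ hK hsec (a := (s + δ) / 2) (b := s) (by linarith) (by linarith)
  have h2 : ((s + δ) / 2 - δ) * ‖φ' ((s + δ) / 2)‖ ≤ (s - δ) * ‖φ' s‖ :=
    hmax ⟨by linarith, by linarith [hs.2]⟩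
  have h3 := mul_le_mul_of_nonneg_left
    (h.norm_antitone hQ hδ (show δ ≤ (s + δ) / 2 by linarith)) (show 0 ≤ K by linarith)
  show (s - δ) * ‖φ' s‖ ≤ _
  linarith

end IsEvolution

end Evolution

/-! ### Auxiliary inequalities -/

theorem MeasureTheory.Lp.ae_abs_le_norm_top {X : Type*} [MeasurableSpace X] {μ : Measure X}
    (c : Lp ℝ ⊤ μ) : ∀ᵐ x ∂μ, |c x| ≤ ‖c‖ := by
  have htop : eLpNormEssSup c μ ≠ ⊤ := by
    rw [← eLpNorm_exponent_top]
    exact Lp.eLpNorm_ne_top c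
  filter_upwards [ae_le_eLpNormEssSup (f := c) (μ := μ)] with x hx
  rw [Lp.norm_def, eLpNorm_exponent_top, ← Real.norm_eq_abs, ← toReal_enorm]
  exact ENNReal.toReal_mono htop hx

theorem hardyConstant_nonneg {X : Type*} [MetricSpace X] [MeasurableSpace X]
    {μ : Measure X} {L : ℝ → ℝ} (hL : HasUniformLowerBound μ L)
    {M : ℝ} (hM : 0 < M) {B : ℝ} (hB : 0 ≤ B) : 0 ≤ hardyConstant L M B := by
  rcases hB.eq_or_lt with rfl | hB
  · simp [hardyConstant]
  · have := hL.pos (1 / (2 * (M * B))) (by positivity)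
    unfold hardyConstant
    positivity

/-- Take the square root of the hypothesis, then apply Young's inequality to the cross term with
weight `κ`. Splitting off `s * e` first keeps its coefficient sharp. -/
theorem mul_le_of_sq_le {p e n γ s κ : ℝ} (he : 0 ≤ e) (hn : 0 ≤ n) (hγ : 0 ≤ γ)
    (hs : 0 ≤ s) (hκ : 0 < κ) (h : p ^ 2 ≤ s ^ 2 * e ^ 2 + γ * n ^ 2) :
    p * e ≤ (s + κ / 2) * e ^ 2 + γ / (2 * κ) * n ^ 2 := by
  have hsq := Real.sq_sqrt hγ
  have h1 : p ≤ s * e + √γ * n := by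
    refine le_of_abs_le (abs_le_of_sq_le_sq ?_ (by positivity))
    nlinarith [mul_nonneg (mul_nonneg hs he) (mul_nonneg (Real.sqrt_nonneg γ) hn)]
  have h2 : √γ * n * e ≤ κ / 2 * e ^ 2 + γ / (2 * κ) * n ^ 2 := by
    have h3 : κ / 2 * e ^ 2 + γ / (2 * κ) * n ^ 2 - √γ * n * e =
        (κ * e - √γ * n) ^ 2 / (2 * κ) := by
      field_simp
      linear_combination -n ^ 2 * hsq
    have : 0 ≤ (κ * e - √γ * n) ^ 2 / (2 * κ) := by positivity
    linarith
  nlinarith [mul_le_mul_of_nonneg_right h1 he]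

namespace ResistanceForm

variable {X : Type*} (E : ResistanceForm X) [MetricSpace X] [CompactSpace X]

/-! ### The embedding into `L²` and the zero order term -/

section L2

variable [MeasurableSpace X] [BorelSpace X]

/-- The embedding of `F` into `L²`. -/
noncomputable def toL2 (hR : ∀ x y, dist x y = E.resistance x y) (μ : Measure X)
    [IsFiniteMeasure μ] : E.domain →ₗ[ℝ] Lp ℝ 2 μ :=
  (ContinuousMap.toLp 2 μ ℝ : C(X, ℝ) →L[ℝ] Lp ℝ 2 μ).toLinearMap ∘ₗ
    { toFun := E.toCont hR
      map_add' := fun _ _ => rfl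
      map_smul' := fun _ _ => rfl }

theorem coeFn_toL2 (hR : ∀ x y, dist x y = E.resistance x y) (μ : Measure X)
    [IsFiniteMeasure μ] (f : E.domain) : E.toL2 hR μ f =ᵐ[μ] (f : X → ℝ) :=
  ContinuousMap.coeFn_toLp μ (E.toCont hR f)

theorem inner_toL2 (hR : ∀ x y, dist x y = E.resistance x y) (μ : Measure X)
    [IsFiniteMeasure μ] (f : Lp ℝ 2 μ) (g : E.domain) :
    ⟪f, E.toL2 hR μ g⟫ = ∫ x, f x * (g : X → ℝ) x ∂μ := by
  rw [L2.inner_def]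
  refine integral_congr_ae ?_
  filter_upwards [E.coeFn_toL2 hR μ g] with x hx
  rw [hx]
  simp [mul_comm]

theorem norm_toL2_sq (hR : ∀ x y, dist x y = E.resistance x y) (μ : Measure X)
    [IsFiniteMeasure μ] (f : E.domain) :
    ‖E.toL2 hR μ f‖ ^ 2 = ∫ x, (f : X → ℝ) x ^ 2 ∂μ := by
  rw [← real_inner_self_eq_norm_sq, inner_toL2]
  refine integral_congr_ae ?_
  filter_upwards [E.coeFn_toL2 hR μ f] with x hx
  rw [hx, sq]

theorem integral_abs_mul_le (hR : ∀ x y, dist x y = E.resistance x y) (μ : Measure X)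
    [IsFiniteMeasure μ] (f g : E.domain) :
    ∫ x, |(f : X → ℝ) x| * |(g : X → ℝ) x| ∂μ ≤ ‖E.toL2 hR μ f‖ * ‖E.toL2 hR μ g‖ := by
  have h : ∫ x, |(f : X → ℝ) x| * |(g : X → ℝ) x| ∂μ =
      ⟪|E.toL2 hR μ f|, |E.toL2 hR μ g|⟫ := by
    rw [L2.inner_def]
    refine integral_congr_ae ?_
    filter_upwards [E.coeFn_toL2 hR μ f, E.coeFn_toL2 hR μ g, Lp.coeFn_abs (E.toL2 hR μ f),
      Lp.coeFn_abs (E.toL2 hR μ g)] with x h1 h2 h3 h4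
    simp only [h3, h4, h1, h2]
    simp [mul_comm]
  rw [h, ← norm_abs_eq_norm (E.toL2 hR μ f), ← norm_abs_eq_norm (E.toL2 hR μ g)]
  exact real_inner_le_norm _ _

theorem integrable_coeff_mul (hR : ∀ x y, dist x y = E.resistance x y) (μ : Measure X)
    [IsFiniteMeasure μ] (c : Lp ℝ ⊤ μ) (f g : E.domain) :
    Integrable (fun x => c x * (f : X → ℝ) x * (g : X → ℝ) x) μ := by
  refine Integrable.of_bound (C := ‖c‖ * ‖E.toCont hR f‖ * ‖E.toCont hR g‖)
    (((Lp.aestronglyMeasurable c).mul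
      (E.continuous_of_mem hR f).aestronglyMeasurable).mul
      (E.continuous_of_mem hR g).aestronglyMeasurable) ?_
  filter_upwards [Lp.ae_abs_le_norm_top c] with x hx
  rw [norm_mul, norm_mul]
  have h1 := (E.toCont hR f).norm_coe_le_norm x
  have h2 := (E.toCont hR g).norm_coe_le_norm x
  exact mul_le_mul (mul_le_mul hx h1 (norm_nonneg _) (norm_nonneg _)) h2 (norm_nonneg _)
    (by positivity)

theorem abs_integral_coeff_mul_le (hR : ∀ x y, dist x y = E.resistance x y) (μ : Measure X)
    [IsFiniteMeasure μ] (c : Lp ℝ ⊤ μ) (f g : E.domain) :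
    |∫ x, c x * (f : X → ℝ) x * (g : X → ℝ) x ∂μ| ≤
      ‖c‖ * (‖E.toL2 hR μ f‖ * ‖E.toL2 hR μ g‖) := by
  have hint : Integrable (fun x => ‖c‖ * (|(f : X → ℝ) x| * |(g : X → ℝ) x|)) μ :=
    (((E.continuous_of_mem hR f).abs.mul
      (E.continuous_of_mem hR g).abs).integrable_of_hasCompactSupport
      (HasCompactSupport.of_compactSpace _)).const_mul _
  rw [← Real.norm_eq_abs]
  refine (norm_integral_le_of_norm_le hint ?_).trans ?_
  · filter_upwards [Lp.ae_abs_le_norm_top c] with x hx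
    rw [norm_mul, norm_mul, mul_assoc]
    exact mul_le_mul_of_nonneg_right hx (by positivity)
  · rw [integral_const_mul]
    exact mul_le_mul_of_nonneg_left (E.integral_abs_mul_le hR μ f g) (norm_nonneg _)

theorem essInf_mul_le (hR : ∀ x y, dist x y = E.resistance x y) (μ : Measure X)
    [IsFiniteMeasure μ] (c : Lp ℝ ⊤ μ) (f : E.domain) :
    essInf (fun x => -c x) μ * ‖E.toL2 hR μ f‖ ^ 2 ≤
      -∫ x, c x * (f : X → ℝ) x * (f : X → ℝ) x ∂μ := by
  have hbdd : IsBoundedUnder (· ≥ ·) (ae μ) (fun x => -c x) := by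
    refine isBoundedUnder_of_eventually_ge (a := -‖c‖) ?_
    filter_upwards [Lp.ae_abs_le_norm_top c] with x hx
    linarith [(abs_le.1 hx).2]
  rw [norm_toL2_sq, ← integral_const_mul, ← integral_neg]
  refine integral_mono_ae ((E.integrable_sq hR μ f).const_mul _)
    (E.integrable_coeff_mul hR μ c f f).neg ?_
  filter_upwards [ae_essInf_le hbdd] with x hx
  have := mul_le_mul_of_nonneg_right hx (sq_nonneg ((f : X → ℝ) x))
  linarith

end L2

/-! ### The bilinear form -/

section Bilin

variable [Nonempty X] [MeasurableSpace X] [BorelSpace X] {V : ℕ → Finset X}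

/-- The sup bound on `g` with radius `1 / (2MB)`, chosen so that the energy term, multiplied by `B`,
has coefficient exactly `1 / M`. -/
theorem norm_fieldAct_toCont_sq_le (hR : ∀ x y, dist x y = E.resistance x y)
    (hV : E.DiscreteInnerConverges V) (μ : Measure X) [IsFiniteMeasure μ] {L : ℝ → ℝ}
    (hL : HasUniformLowerBound μ L) {M : ℝ} (hM : 0 < M) {b : E.VectorField V} {B : ℝ}
    (hb : ‖b‖ ^ 2 ≤ B) (g : E.domain) :
    ‖E.fieldAct V (E.toCont hR g) b‖ ^ 2 ≤
      1 / M * E.form g g + hardyConstant L M B * ‖E.toL2 hR μ g‖ ^ 2 := by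
  have h1 : ‖E.fieldAct V (E.toCont hR g) b‖ ^ 2 ≤ ‖E.toCont hR g‖ ^ 2 * B := by
    refine (pow_le_pow_left₀ (norm_nonneg _) (E.norm_fieldAct_le hV _ b) 2).trans ?_
    rw [mul_pow]
    exact mul_le_mul_of_nonneg_left hb (sq_nonneg _)
  have hB : 0 ≤ B := (sq_nonneg _).trans hb
  -- For `B = 0` there is no such radius, but then the left side vanishes, and the Hardy constant is
  -- zero through its factor `B`.
  rcases hB.eq_or_lt with rfl | hB
  · refine h1.trans ?_
    simp only [hardyConstant, mul_zero, zero_mul, add_zero]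
    have := E.nonneg g
    positivity
  · have hr : 0 < 1 / (2 * (M * B)) := by positivity
    have h2 := mul_le_mul_of_nonneg_right (E.norm_toCont_sq_le hR μ hL hr g) hB.le
    refine h1.trans (h2.trans (le_of_eq ?_))
    rw [hardyConstant, norm_toL2_sq]
    have : 2 * (1 / (2 * (M * B))) * B = 1 / M := by field_simp
    linear_combination E.form g g * this

/-- The form `Q` as a bilinear map. -/
noncomputable def bilinMap (hR : ∀ x y, dist x y = E.resistance x y)
    (hV : E.DiscreteInnerConverges V) (μ : Measure X) [IsFiniteMeasure μ]
    (a : C(X, ℝ)) (b b' : E.VectorField V) (c : Lp ℝ ⊤ μ) : E.domain →ₗ[ℝ] E.domain →ₗ[ℝ] ℝ :=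
  LinearMap.mk₂ ℝ (E.bilin hR V μ a b b' c)
    (fun f f' g => by
      have h1 : E.toCont hR (f + f') = E.toCont hR f + E.toCont hR f' := rfl
      have h2 : ∫ x, c x * ((f + f' : E.domain) : X → ℝ) x * (g : X → ℝ) x ∂μ =
          ∫ x, c x * (f : X → ℝ) x * (g : X → ℝ) x ∂μ +
          ∫ x, c x * (f' : X → ℝ) x * (g : X → ℝ) x ∂μ := by
        rw [← integral_add (E.integrable_coeff_mul hR μ c f g) (E.integrable_coeff_mul hR μ c f' g)]
        refine integral_congr_ae (.of_forall fun x => ?_)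
        simp only [Submodule.coe_add, Pi.add_apply]
        ring
      simp only [bilin, h1, h2, E.grad_add, E.fieldAct_add_right hV, E.fieldAct_add_left hV,
        inner_add_left, inner_add_right]
      ring)
    (fun r f g => by
      have h1 : E.toCont hR (r • f) = r • E.toCont hR f := rfl
      have h2 : ∫ x, c x * ((r • f : E.domain) : X → ℝ) x * (g : X → ℝ) x ∂μ =
          r * ∫ x, c x * (f : X → ℝ) x * (g : X → ℝ) x ∂μ := by
        rw [← integral_const_mul]
        refine integral_congr_ae (.of_forall fun x => ?_)
        simp only [Submodule.coe_smul, Pi.smul_apply, smul_eq_mul]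
        ring
      simp only [bilin, h1, h2, E.grad_smul, E.fieldAct_smul_right hV, E.fieldAct_smul_left hV,
        real_inner_smul_left, real_inner_smul_right, smul_eq_mul]
      ring)
    (fun f g g' => by
      have h1 : E.toCont hR (g + g') = E.toCont hR g + E.toCont hR g' := rfl
      have h2 : ∫ x, c x * (f : X → ℝ) x * ((g + g' : E.domain) : X → ℝ) x ∂μ =
          ∫ x, c x * (f : X → ℝ) x * (g : X → ℝ) x ∂μ +
          ∫ x, c x * (f : X → ℝ) x * (g' : X → ℝ) x ∂μ := by
        rw [← integral_add (E.integrable_coeff_mul hR μ c f g) (E.integrable_coeff_mul hR μ c f g')]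
        refine integral_congr_ae (.of_forall fun x => ?_)
        simp only [Submodule.coe_add, Pi.add_apply]
        ring
      simp only [bilin, h1, h2, E.grad_add, E.fieldAct_add_left hV,
        inner_add_left, inner_add_right]
      ring)
    (fun r f g => by
      have h1 : E.toCont hR (r • g) = r • E.toCont hR g := rfl
      have h2 : ∫ x, c x * (f : X → ℝ) x * ((r • g : E.domain) : X → ℝ) x ∂μ =
          r * ∫ x, c x * (f : X → ℝ) x * (g : X → ℝ) x ∂μ := by
        rw [← integral_const_mul]
        refine integral_congr_ae (.of_forall fun x => ?_)
        simp only [Submodule.coe_smul, Pi.smul_apply, smul_eq_mul]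
        ring
      simp only [bilin, h1, h2, E.grad_smul, E.fieldAct_smul_left hV,
        real_inner_smul_left, real_inner_smul_right, smul_eq_mul]
      ring)

/-- Coercivity of the form `Q`. -/
theorem le_bilin_self (hR : ∀ x y, dist x y = E.resistance x y) (hVm : Monotone V)
    (hVd : Dense (⋃ m, (V m : Set X))) (μ : Measure X) [IsFiniteMeasure μ] {L : ℝ → ℝ}
    (hL : HasUniformLowerBound μ L) {lam : ℝ} {a : C(X, ℝ)} (ha : ∀ x, lam ≤ a x) {M : ℝ}
    (hM : 0 < M) (hlam : 0 < lam / 2 - 1 / √M) {b b' : E.VectorField V} {B B' : ℝ}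
    (hb : ‖b‖ ^ 2 ≤ B) (hb' : ‖b'‖ ^ 2 ≤ B') (c : Lp ℝ ⊤ μ) (f : E.domain) :
    (lam / 2 - 1 / √M) * E.form f f + (essInf (fun x => -c x) μ -
      (hardyConstant L M B + hardyConstant L M B') / (lam - 2 / √M)) * ‖E.toL2 hR μ f‖ ^ 2 ≤
      E.bilin hR V μ a b b' c f f := by
  have hV := E.discreteInnerConverges hR hVm hVd
  have hs : 0 ≤ 1 / √M := by positivity
  have hs2 : (1 / √M) ^ 2 = 1 / M := by rw [div_pow, Real.sq_sqrt hM.le, one_pow]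
  have hγ := hardyConstant_nonneg hL hM ((sq_nonneg _).trans hb)
  have hγ' := hardyConstant_nonneg hL hM ((sq_nonneg _).trans hb')
  -- Each drift term costs `1/√M + lam₀/2` of the energy, with `lam₀ = lam/2 - 1/√M`; subtracting
  -- both from `lam` leaves exactly `lam₀`.
  have key : ∀ {b : E.VectorField V} {B : ℝ}, ‖b‖ ^ 2 ≤ B →
      ⟪E.fieldAct V (E.toCont hR f) b, E.grad V f⟫ ≤
        (1 / √M + (lam / 2 - 1 / √M) / 2) * E.form f f +
        hardyConstant L M B / (2 * (lam / 2 - 1 / √M)) * ‖E.toL2 hR μ f‖ ^ 2 := by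
    intro b B hb
    refine (real_inner_le_norm _ _).trans ?_
    have h1 := E.norm_fieldAct_toCont_sq_le hR hV μ hL hM hb f
    rw [← hs2] at h1
    rw [← E.norm_grad_sq hR hVm hVd] at h1 ⊢
    exact mul_le_of_sq_le (norm_nonneg _) (norm_nonneg _)
      (hardyConstant_nonneg hL hM ((sq_nonneg _).trans hb)) hs hlam h1
  have h1 := key hb
  have h2 := key hb'
  have h3 := E.le_inner_fieldAct_grad hR hVm hVd ha f
  have h4 := E.essInf_mul_le hR μ c f
  have h5 : lam - 2 / √M = 2 * (lam / 2 - 1 / √M) := by ring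
  rw [bilin, h5, add_div]
  linarith

/-- Continuity of the form `Q`. -/
theorem abs_bilin_le (hR : ∀ x y, dist x y = E.resistance x y) (hVm : Monotone V)
    (hVd : Dense (⋃ m, (V m : Set X))) (μ : Measure X) [IsFiniteMeasure μ] {L : ℝ → ℝ}
    (hL : HasUniformLowerBound μ L) {Lam : ℝ} {a : C(X, ℝ)} (ha : ‖a‖ ≤ Lam) {M : ℝ}
    (hM : 0 < M) {b b' : E.VectorField V} {B B' : ℝ}
    (hb : ‖b‖ ^ 2 ≤ B) (hb' : ‖b'‖ ^ 2 ≤ B') (c : Lp ℝ ⊤ μ) (f g : E.domain) :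
    |E.bilin hR V μ a b b' c f g| ≤
      (Lam + √(1 / M + hardyConstant L M B) + √(1 / M + hardyConstant L M B') + ‖c‖) *
        (√(E.form f f + ‖E.toL2 hR μ f‖ ^ 2) * √(E.form g g + ‖E.toL2 hR μ g‖ ^ 2)) := by
  have hV := E.discreteInnerConverges hR hVm hVd
  set N : E.domain → ℝ := fun f => √(E.form f f + ‖E.toL2 hR μ f‖ ^ 2) with hN
  have hgrad : ∀ f, ‖E.grad V f‖ ≤ N f := fun f => by
    apply Real.le_sqrt_of_sq_le
    rw [E.norm_grad_sq hR hVm hVd]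
    linarith [sq_nonneg ‖E.toL2 hR μ f‖]
  have hL2 : ∀ f, ‖E.toL2 hR μ f‖ ≤ N f := fun f => by
    apply Real.le_sqrt_of_sq_le
    linarith [E.nonneg f]
  have hact : ∀ {b : E.VectorField V} {B : ℝ}, ‖b‖ ^ 2 ≤ B → ∀ f,
      ‖E.fieldAct V (E.toCont hR f) b‖ ≤ √(1 / M + hardyConstant L M B) * N f := by
    intro b B hb f
    have hγ := hardyConstant_nonneg hL hM ((sq_nonneg _).trans hb)
    rw [hN, ← Real.sqrt_mul (by positivity)]
    apply Real.le_sqrt_of_sq_le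
    refine (E.norm_fieldAct_toCont_sq_le hR hV μ hL hM hb f).trans ?_
    have h1 : 0 ≤ 1 / M * ‖E.toL2 hR μ f‖ ^ 2 := by positivity
    have h2 := mul_nonneg hγ (E.nonneg f)
    linarith
  have hN0 : ∀ f, 0 ≤ N f := fun f => Real.sqrt_nonneg _
  have h1 : |⟪E.fieldAct V a (E.grad V f), E.grad V g⟫| ≤ Lam * (N f * N g) := by
    refine (abs_real_inner_le_norm _ _).trans ?_
    rw [← mul_assoc]
    refine mul_le_mul ((E.norm_fieldAct_le hV _ _).trans ?_) (hgrad g) (norm_nonneg _)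
      (mul_nonneg ((norm_nonneg _).trans ha) (hN0 f))
    exact mul_le_mul ha (hgrad f) (norm_nonneg _) ((norm_nonneg _).trans ha)
  have h2 : |⟪E.fieldAct V (E.toCont hR g) b, E.grad V f⟫| ≤
      √(1 / M + hardyConstant L M B) * (N f * N g) := by
    refine (abs_real_inner_le_norm _ _).trans ?_
    rw [mul_comm (N f), ← mul_assoc]
    exact mul_le_mul (hact hb g) (hgrad f) (norm_nonneg _)
      (mul_nonneg (Real.sqrt_nonneg _) (hN0 g))
  have h3 : |⟪E.fieldAct V (E.toCont hR f) b', E.grad V g⟫| ≤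
      √(1 / M + hardyConstant L M B') * (N f * N g) := by
    refine (abs_real_inner_le_norm _ _).trans ?_
    rw [← mul_assoc]
    exact mul_le_mul (hact hb' f) (hgrad g) (norm_nonneg _)
      (mul_nonneg (Real.sqrt_nonneg _) (hN0 f))
  have h4 : |∫ x, c x * (f : X → ℝ) x * (g : X → ℝ) x ∂μ| ≤ ‖c‖ * (N f * N g) :=
    (E.abs_integral_coeff_mul_le hR μ c f g).trans (mul_le_mul_of_nonneg_left
      (mul_le_mul (hL2 f) (hL2 g) (norm_nonneg _) (hN0 f)) (norm_nonneg _))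
  rw [bilin]
  rw [abs_le] at h1 h2 h3 h4 ⊢
  constructor <;> linarith

end Bilin

/-! ### Compactness -/

section Compactness

/-- Sequences that are bounded in energy and in `L²` have uniformly convergent subsequences, and
the limits have finite energy. -/
theorem exists_tendstoUniformly [Nonempty X] [MeasurableSpace X] [BorelSpace X]
    (hR : ∀ x y, dist x y = E.resistance x y) {V : ℕ → Finset X} (hVm : Monotone V)
    (hVd : Dense (⋃ m, (V m : Set X))) (μ : Measure X) [IsFiniteMeasure μ] {L : ℝ → ℝ}
    (hL : HasUniformLowerBound μ L) {C : ℝ} (u : ℕ → E.domain)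
    (hu : ∀ n, E.form (u n) (u n) + ‖E.toL2 hR μ (u n)‖ ^ 2 ≤ C) :
    ∃ ψ : ℕ → ℕ, StrictMono ψ ∧ ∃ w : E.domain,
      TendstoUniformly (fun k => (u (ψ k) : X → ℝ)) (w : X → ℝ) atTop := by
  have hen : ∀ n, E.form (u n) (u n) ≤ C := fun n => by
    linarith [hu n, sq_nonneg ‖E.toL2 hR μ (u n)‖]
  have hC : 0 ≤ C := (E.nonneg _).trans (hen 0)
  have hL1 := hL.pos 1 one_pos
  set R := √(2 / L 1 * C + 2 * 1 * C) with hRdef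
  have hsup : ∀ n x, |(u n : X → ℝ) x| ≤ R := by
    intro n x
    apply Real.le_sqrt_of_sq_le
    rw [sq_abs]
    refine (E.sq_le_energy hR μ hL one_pos (u n) x).trans ?_
    rw [← E.norm_toL2_sq hR]
    have h1 : ‖E.toL2 hR μ (u n)‖ ^ 2 ≤ C := by linarith [hu n, E.nonneg (u n)]
    have h2 := mul_le_mul_of_nonneg_left h1 (show 0 ≤ 2 / L 1 by positivity)
    linarith [hen n]
  set U : ℕ → BoundedContinuousFunction X ℝ :=
    fun n => BoundedContinuousFunction.mkOfCompact (E.toCont hR (u n)) with hU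
  have hcomp : IsCompact (closure (Set.range U)) := by
    refine BoundedContinuousFunction.arzela_ascoli (Set.Icc (-R) R) isCompact_Icc _ ?_ ?_
    · rintro _ x ⟨n, rfl⟩
      exact abs_le.1 (hsup n x)
    · intro x
      refine Metric.equicontinuousAt_of_continuity_modulus (fun y => √(dist x y * C)) ?_ _ ?_
      · have : ContinuousAt (fun y => √(dist x y * C)) x := by fun_prop
        simpa [ContinuousAt] using this
      · refine .of_forall fun y => ?_
        rintro ⟨_, n, rfl⟩
        rw [Real.dist_eq]
        apply Real.le_sqrt_of_sq_le
        rw [sq_abs]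
        refine (E.sq_sub_le (u n) x y).trans ?_
        rw [← hR]
        exact mul_le_mul_of_nonneg_left (hen n) dist_nonneg
  obtain ⟨w, -, ψ, hψ, hw⟩ := hcomp.tendsto_subseq fun n => subset_closure ⟨n, rfl⟩
  rw [BoundedContinuousFunction.tendsto_iff_tendstoUniformly] at hw
  -- Lower semicontinuity of the energy: a trace energy is a finite sum, hence continuous under
  -- pointwise convergence.
  have htr : ∀ m, E.traceEnergy (V m) w ≤ C := by
    intro m
    have h1 : Tendsto (fun k => E.traceEnergy (V m) (u (ψ k))) atTop
        (𝓝 (E.traceEnergy (V m) w)) := by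
      simp only [← traceForm_self, ← discreteInner_univDeriv, discreteInner, univDeriv]
      refine (tendsto_finsetSum _ fun p _ => tendsto_finsetSum _ fun q _ => ?_).const_mul _
      have h2 : Tendsto (fun k => (u (ψ k) : X → ℝ) p - (u (ψ k) : X → ℝ) q) atTop
          (𝓝 (w p - w q)) := (hw.tendsto_at p).sub (hw.tendsto_at q)
      exact (h2.const_mul _).mul h2
    exact le_of_tendsto' h1 fun k => (E.traceEnergy_le (V m) _).trans (hen _)
  obtain ⟨w', hw', -⟩ := E.exists_eq_of_traceEnergy_le hR hVm hVd w.continuous htr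
  exact ⟨ψ, hψ, w', by rw [hw']; exact hw⟩

end Compactness

end ResistanceForm

/-! ### Energy bound for Cauchy solutions -/

namespace ResistanceForm

variable {X : Type*} (E : ResistanceForm X) [MetricSpace X] [CompactSpace X]

/-- A Cauchy solution in `L²` at positive times is controlled by its initial value, if the form is
nonnegative and satisfies the sector condition. -/
theorem IsCauchySolution.exists_representative [MeasurableSpace X] [BorelSpace X]
    (hR : ∀ x y, dist x y = E.resistance x y) (μ : Measure X) [IsFiniteMeasure μ]
    {Q : E.domain →ₗ[ℝ] E.domain →ₗ[ℝ] ℝ} (hQ : ∀ f, 0 ≤ Q f f) {K : ℝ} (hK : 1 ≤ K)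
    (hsec : ∀ f g, Q f g ^ 2 ≤ K * (Q f f * Q g g)) {u₀ : Lp ℝ 2 μ} {u : ℝ → Lp ℝ 2 μ}
    (h : E.IsCauchySolution μ (fun f g => Q f g) u₀ u) {t : ℝ} (ht : 0 < t) :
    ∃ v : E.domain, u t =ᵐ[μ] (v : X → ℝ) ∧ Q v v ≤ 64 * K / t * ‖u₀‖ ^ 2 := by
  have hrep : ∀ t > 0, ∃ v : E.domain, u t =ᵐ[μ] (v : X → ℝ) ∧ E.toL2 hR μ v = u t ∧
      ∀ g, Q v g = -⟪deriv u t, E.toL2 hR μ g⟫ := by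
    intro t ht
    obtain ⟨v, hv, hv'⟩ := h.equation t ht
    refine ⟨v, hv, Lp.ext ((E.coeFn_toL2 hR μ v).trans hv.symm), fun g => ?_⟩
    rw [inner_toL2]
    exact hv' g
  have hevol : IsEvolution (E.toL2 hR μ) Q u (deriv u) := by
    refine ⟨fun t ht => ?_, fun t ht => ?_⟩
    · exact ((h.contDiffOn.differentiableOn one_ne_zero).differentiableAt
        (Ioi_mem_nhds ht)).hasDerivAt
    · obtain ⟨v, -, hv, hv'⟩ := hrep t ht
      exact ⟨v, hv, hv'⟩
  have hcont : ContinuousOn (deriv u) (Set.Ioi 0) :=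
    h.contDiffOn.continuousOn_deriv_of_isOpen isOpen_Ioi le_rfl
  have hbound : ∀ s > 0, ‖u s‖ ≤ ‖u₀‖ := by
    intro s hs
    -- The norm is known to decrease only at positive times; continuity at `0` brings in the initial
    -- value.
    have h0 : Tendsto (fun r => ‖u r‖) (𝓝[>] 0) (𝓝 ‖u₀‖) := by
      rw [← h.initial]
      exact ((h.continuousOn 0 Set.self_mem_Ici).mono_left
        (nhdsWithin_mono _ Set.Ioi_subset_Ici_self)).norm
    refine ge_of_tendsto h0 ?_
    filter_upwards [Ioc_mem_nhdsGT hs] with r hr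
    exact hevol.norm_antitone hQ hr.1 hr.2
  obtain ⟨v, hv, hvt, hv'⟩ := hrep t ht
  refine ⟨v, hv, ?_⟩
  -- The smoothing bound is started at `t / 2`, which doubles the constant 32.
  have h1 := hevol.mul_norm_deriv_le hcont hQ hK hsec (half_pos ht) (half_le_self ht.le)
  have h2 : ‖deriv u t‖ ≤ 64 * K / t * ‖u₀‖ := by
    rw [div_mul_eq_mul_div, le_div_iff₀ ht]
    have := mul_le_mul_of_nonneg_left (hbound (t / 2) (half_pos ht)) (show 0 ≤ K by linarith)
    linarith
  rw [hv', hvt, ← inner_neg_left]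
  refine (real_inner_le_norm _ _).trans ?_
  rw [norm_neg, sq, ← mul_assoc]
  exact mul_le_mul h2 (hbound t ht) (norm_nonneg _) (by positivity)

end ResistanceForm

/-! ### Uniform bounds and conclusion -/

theorem corollary4p6 {X : Type*} [Nonempty X] [MetricSpace X] [CompactSpace X]
    [MeasurableSpace X] [BorelSpace X]
    -- a resistance form whose resistance metric is the (compact) metric of `X`
    (E : ResistanceForm X) (hR : ∀ x y, dist x y = E.resistance x y)
    -- an increasing sequence of finite sets with dense union, used to define the vector fields
    (V : ℕ → Finset X) (hVmono : ∀ m, V m ⊆ V (m + 1))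
    (hVdense : Dense (⋃ m, (V m : Set X)))
    -- a finite Borel measure with a uniform lower bound
    (μ : MeasureTheory.Measure X) [MeasureTheory.IsFiniteMeasure μ]
    (L : ℝ → ℝ) (hL : HasUniformLowerBound μ L)
    -- the coefficients
    (lam Lam : ℝ) (hlam : 0 < lam) (hlamLam : lam < Lam)
    (a : ℕ → C(X, ℝ)) (ha : ∀ m x, lam < a m x ∧ a m x < Lam)
    (b b' : ℕ → E.VectorField V)
    (hb : BddAbove (Set.range fun m => ‖b m‖ ^ 2))
    (hb' : BddAbove (Set.range fun m => ‖b' m‖ ^ 2))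
    -- the smallness conditions `lam₀ > 0` and `c₀ > 0`
    (M : ℝ) (hM : 0 < M) (hlam0 : 0 < lam / 2 - 1 / √M)
    (c : MeasureTheory.Lp ℝ ⊤ μ)
    (hc : 0 < essInf (fun x => -c x) μ -
      (hardyConstant L M (⨆ m, ‖b m‖ ^ 2) + hardyConstant L M (⨆ m, ‖b' m‖ ^ 2)) /
        (lam - 2 / √M)) :
    -- elliptic equations
    (∀ (f : MeasureTheory.Lp ℝ 2 μ) (u : ℕ → E.domain),
      (∀ m, E.IsWeakSolution μ (E.bilin hR V μ (a m) (b m) (b' m) c) f (u m)) →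
      ∀ φ : ℕ → ℕ, StrictMono φ → ∃ ψ : ℕ → ℕ, StrictMono ψ ∧ ∃ w : E.domain,
        TendstoUniformly (fun k => (u (φ (ψ k)) : X → ℝ)) (w : X → ℝ) atTop) ∧
    -- parabolic equations; `v m` is the representative in `F` of the class `u m t`
    (∀ (u₀ : MeasureTheory.Lp ℝ 2 μ) (u : ℕ → ℝ → MeasureTheory.Lp ℝ 2 μ),
      (∀ m, E.IsCauchySolution μ (E.bilin hR V μ (a m) (b m) (b' m) c) u₀ (u m)) →
      ∀ t : ℝ, 0 < t → ∃ v : ℕ → E.domain, (∀ m, u m t =ᵐ[μ] (v m : X → ℝ)) ∧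
        ∀ φ : ℕ → ℕ, StrictMono φ → ∃ ψ : ℕ → ℕ, StrictMono ψ ∧ ∃ w : E.domain,
          TendstoUniformly (fun k => (v (φ (ψ k)) : X → ℝ)) (w : X → ℝ) atTop) := by
  have hVm : Monotone V := monotone_nat_of_le_succ hVmono
  have hV := E.discreteInnerConverges hR hVm hVdense
  set B := ⨆ m, ‖b m‖ ^ 2
  set B' := ⨆ m, ‖b' m‖ ^ 2
  have hB : ∀ m, ‖b m‖ ^ 2 ≤ B := le_ciSup hb
  have hB' : ∀ m, ‖b' m‖ ^ 2 ≤ B' := le_ciSup hb'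
  set κ := min (lam / 2 - 1 / √M) (essInf (fun x => -c x) μ -
      (hardyConstant L M B + hardyConstant L M B') / (lam - 2 / √M)) with hκdef
  have hκ : 0 < κ := lt_min hlam0 hc
  set N : E.domain → ℝ := fun f => E.form f f + ‖E.toL2 hR μ f‖ ^ 2 with hN
  have hN0 : ∀ f, 0 ≤ N f := fun f => add_nonneg (E.nonneg f) (sq_nonneg _)
  set Q := fun m => E.bilinMap hR hV μ (a m) (b m) (b' m) c
  have hcoer : ∀ m f, κ * N f ≤ Q m f f := fun m f => by
    refine le_trans ?_ (E.le_bilin_self hR hVm hVdense μ hL (fun x => (ha m x).1.le) hM hlam0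
      (hB m) (hB' m) c f)
    have h1 := mul_le_mul_of_nonneg_right (min_le_left _ _ : κ ≤ _) (E.nonneg f)
    have h2 := mul_le_mul_of_nonneg_right (min_le_right _ _ : κ ≤ _)
      (sq_nonneg ‖E.toL2 hR μ f‖)
    rw [mul_add]
    exact add_le_add h1 h2
  have hQ : ∀ m f, 0 ≤ Q m f f := fun m f => (mul_nonneg hκ.le (hN0 f)).trans (hcoer m f)
  have hfin : ∀ (C : ℝ) (u : ℕ → E.domain), (∀ n, N (u n) ≤ C) →
      ∀ φ : ℕ → ℕ, StrictMono φ → ∃ ψ : ℕ → ℕ, StrictMono ψ ∧ ∃ w : E.domain,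
        TendstoUniformly (fun k => (u (φ (ψ k)) : X → ℝ)) (w : X → ℝ) atTop :=
    fun C u hu φ _ => E.exists_tendstoUniformly hR hVm hVdense μ hL (fun n => u (φ n))
      fun n => hu (φ n)
  refine ⟨fun f u hu => ?_, fun u₀ u hu t ht => ?_⟩
  · refine hfin (‖f‖ ^ 2 / κ ^ 2) u fun m => ?_
    -- Test the equation with `u m` itself.
    have h1 : κ * N (u m) ≤ ‖f‖ * √(N (u m)) := by
      refine (hcoer m (u m)).trans ?_
      have h2 : Q m (u m) (u m) = -⟪f, E.toL2 hR μ (u m)⟫ := by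
        rw [E.inner_toL2]
        exact hu m (u m)
      rw [h2, ← inner_neg_right]
      refine (real_inner_le_norm _ _).trans (mul_le_mul_of_nonneg_left ?_ (norm_nonneg _))
      rw [norm_neg]
      exact Real.le_sqrt_of_sq_le (by linarith [E.nonneg (u m)])
    have h3 : κ * √(N (u m)) ≤ ‖f‖ := by
      rcases (Real.sqrt_nonneg (N (u m))).eq_or_lt with h0 | h0
      · rw [← h0, mul_zero]
        exact norm_nonneg _
      · refine le_of_mul_le_mul_right ?_ h0
        rwa [mul_assoc, Real.mul_self_sqrt (hN0 _)]
    rw [le_div_iff₀ (by positivity), ← Real.sq_sqrt (hN0 (u m)), ← mul_pow, mul_comm]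
    exact pow_le_pow_left₀ (by positivity) h3 2
  · set K₀ := Lam + √(1 / M + hardyConstant L M B) + √(1 / M + hardyConstant L M B') + ‖c‖
    -- Boundedness squared divided by coercivity squared gives the sector constant, uniform in `m`;
    -- the smoothing estimate also requires it to be at least `1`.
    set K := max 1 (K₀ ^ 2 / κ ^ 2)
    have hsec : ∀ m f g, Q m f g ^ 2 ≤ K * (Q m f f * Q m g g) := by
      intro m f g
      have ham : ‖a m‖ ≤ Lam := by
        rw [ContinuousMap.norm_le _ (by linarith)]
        intro x
        rw [Real.norm_eq_abs, abs_le]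
        constructor <;> linarith [(ha m x).1, (ha m x).2]
      have h1 := E.abs_bilin_le hR hVm hVdense μ hL ham hM (hB m) (hB' m) c f g
      have h2 : Q m f g ^ 2 ≤ K₀ ^ 2 * (N f * N g) := by
        refine (sq_le_sq' (abs_le.1 h1).1 (abs_le.1 h1).2).trans (le_of_eq ?_)
        rw [mul_pow, mul_pow, Real.sq_sqrt (hN0 f), Real.sq_sqrt (hN0 g)]
      have h3 : κ ^ 2 * (N f * N g) ≤ Q m f f * Q m g g := by
        have := mul_le_mul (hcoer m f) (hcoer m g) (mul_nonneg hκ.le (hN0 g)) (hQ m f)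
        linarith
      calc Q m f g ^ 2 ≤ K₀ ^ 2 * (N f * N g) := h2
        _ = K₀ ^ 2 / κ ^ 2 * (κ ^ 2 * (N f * N g)) := by field_simp
        _ ≤ K₀ ^ 2 / κ ^ 2 * (Q m f f * Q m g g) := mul_le_mul_of_nonneg_left h3 (by positivity)
        _ ≤ K * (Q m f f * Q m g g) :=
          mul_le_mul_of_nonneg_right (le_max_right _ _) (mul_nonneg (hQ m f) (hQ m g))
    have hrep : ∀ m, ∃ v : E.domain, u m t =ᵐ[μ] (v : X → ℝ) ∧
        Q m v v ≤ 64 * K / t * ‖u₀‖ ^ 2 := fun m =>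
      ResistanceForm.IsCauchySolution.exists_representative E hR μ (hQ m) (le_max_left _ _)
        (hsec m) (hu m) ht
    choose v hv hvQ using hrep
    refine ⟨v, hv, hfin (64 * K / t * ‖u₀‖ ^ 2 / κ) v fun m => ?_⟩
    rw [le_div_iff₀ hκ, mul_comm]
    exact (hcoer m (v m)).trans (hvQ m)
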